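/- **Setting.** Let $\beta\in[0,1)$, let $\mathsf Z$ be a Borel subset of $\mathbb R^m$, and let $(z_t,\zeta_t,\eta_t)_{t\ge 1}$ be iid, where $z_t$ is $\mathsf Z$-valued, $\zeta_t$ and $\eta_t$ take values in measurable spaces, and $z_t,\zeta_t,\eta_t$ are mutually independent for each $t$. Let $R_t=R(z_t,\zeta_t)$ and $Y_t=Y(z_t,\eta_t)$, where $R,Y\ge 0$ are real-valued and measurable (so $(R_t,Y_t)$ is iid, while $R_t$ and $Y_t$ may depend on each other through $z_t$). Write $(\hat z,\hat R,\hat Y)$ for a copy of $(z_t,R_t,Y_t)$. A *feasible policy* is a Borel function $c$ on $(0,\infty)\times\mathsf Z$ with $0\le c(a,z)\le a$, extended by $c(0,z)=0$. Its asset path from $(a_0,z_0)=(a,z)$ is $a_{t+1}=R_{t+1}(a_t-c(a_t,z_t))+Y_{t+1}$, and its lifetime value is $V_c(a,z)=\mathbb E_{a,z}\sum_{t\ge 0}\beta^t u(c(a_t,z_t))$. A feasible policy $c^*$ is *optimal* if $V_c\le V_{c^*}$ on $(0,\infty)\times\mathsf Z$ for every feasible $c$. Let $\mathscr C$ be the set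 of functions $c$ on $(0,\infty)\times\mathsf Z$ that are continuous, increasing in the first argument, satisfy $0<c(a,z)\le a$, and satisfy $\sup_{a,z}|u'(c(a,z))-u'(a)|<\infty$. **Assumptions** (with $u'(0)=\infty$ and $0\cdot\infty=0$). 1. $u:[0,\infty)\to\mathbb R\cup\{-\infty\}$ is finite and twice differentiable on $(0,\infty)$ with $u'>0$, $u''<0$ there, $u(0)\le\lim_{c\downarrow0}u(c)$, $u'(c)\to\infty$ as $c\downarrow 0$ and $u'(c)\to 0$ as $c\to\infty$. 2. $\beta^n\,\mathbb E R_1\cdots R_n<1$ for some $n\in\mathbb N$. 3. $\sum_{t\ge1}\beta^t\,\mathbb E Y_t<\infty$. 4. $\mathbb E\hat R<\infty$, $\mathbb E u'(\hat Y)<\infty$ and $\mathbb E\hat R\,u'(\hat Y)<\infty$. 5. $z\mapsto R(z,\zeta)$ and $z\mapsto Y(z,\eta)$ are continuous for all $\zeta,\eta$. 6. There is $\alpha\in(0,1)$ such that $\beta\,\mathbb E\hat R\,u'[\hat R(1-\alpha)a]\le u'(a)$ for all $a>0$, and $(1-\alpha)^n\,\mathbb E R_1\cdots R_n<1$ for some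 $n\in\mathbb N$. 7. $\sup_{t\ge1}\mathbb E Y_t<\infty$. 8. For every $c\in\mathscr C$ that is concave in its first argument, the map $s\mapsto (u')^{-1}\bigl[\beta\,\mathbb E\hat R\,(u'\circ c)(\hat R s+\hat Y,\hat z)\bigr]$ is concave on $[0,\infty)$ (a condition that is void if $\beta\hat R=0$ almost surely, when the bracket is identically $0$). **Theorem.** Under these assumptions there is a unique optimal policy $c^*$; it belongs to $\mathscr C$ and depends on wealth only, $c^*(a,z)=c^*(a)$. Let $Q$ be the stochastic kernel on $[0,\infty)$ of the wealth process $$a_{t+1}=R_{t+1}\,[a_t-c^*(a_t)]+Y_{t+1}.$$ Then $Q$ is globally stable: it has a unique stationary distribution $\psi$ among the Borel probability measures on $[0,\infty)$, and for every Borel probability measure $\psi_0$ on $[0,\infty)$ the measures $\psi_0Q^t$ converge weakly to $\psi$ as $t\to\infty$. -/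

import Mathlib

open MeasureTheory ProbabilityTheory Filter Topology Set
open scoped NNReal ENNReal BoundedContinuousFunction

/-- The primitives of the income fluctuation problem with an iid exogenous state.
`Z` is the space of the exogenous state, `E` and `F` are the spaces of the innovations to
returns and to labour income. The state `z_t` is iid with law `lawZ`, that is, its Markov kernel
is `P(z, ·) = lawZ` for every `z`. -/
structure IncomeFluctuation (Z E F : Type*) [MeasurableSpace Z] [MeasurableSpace E]
    [MeasurableSpace F] where
  /-- discount factor -/
  β : ℝ≥0
  β_lt_one : β < 1
  /-- utility on `[0, ∞)`, with values in `ℝ ∪ {-∞}` -/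
  u : ℝ≥0 → EReal
  /-- gross return as a function of the exogenous state and the innovation -/
  R : Z × E → ℝ≥0
  measurable_R : Measurable R
  /-- labour income as a function of the exogenous state and the innovation -/
  Y : Z × F → ℝ≥0
  measurable_Y : Measurable Y
  /-- law of `z_t`, `t ≥ 1` -/
  lawZ : Measure Z
  isProb_lawZ : IsProbabilityMeasure lawZ
  /-- law of the return innovations -/
  lawζ : Measure E
  isProb_lawζ : IsProbabilityMeasure lawζ
  /-- law of the income innovations -/
  lawη : Measure F
  isProb_lawη : IsProbabilityMeasure lawη

namespace IncomeFluctuation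

noncomputable section

variable {Z E F : Type*} [MeasurableSpace Z] [MeasurableSpace E] [MeasurableSpace F]

/-- The utility as a real function; only its values on `(0, ∞)`, where `u` is finite, matter. -/
def uReal (M : IncomeFluctuation Z E F) (x : ℝ) : ℝ := (M.u x.toNNReal).toReal

/-- Marginal utility `u'` on `(0, ∞)`. -/
def u' (M : IncomeFluctuation Z E F) : ℝ → ℝ := deriv M.uReal

/-- Marginal utility as a function from `[0, ∞)` to `[0, ∞]`, with `u'(0) = ∞`.
Products with it follow the convention `0 * ∞ = 0`. -/
def marg (M : IncomeFluctuation Z E F) (x : ℝ≥0) : ℝ≥0∞ :=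
  if x = 0 then ⊤ else ENNReal.ofReal (M.u' x)

/-- The standing assumption on the utility function. The field `zero_le` says that the value at
zero does not exceed the limit at zero, i.e. that `u` is increasing (equivalently, concave) on
all of `[0, ∞)`. -/
structure UtilityAssumption (M : IncomeFluctuation Z E F) : Prop where
  ne_top : ∀ x, M.u x ≠ ⊤
  ne_bot : ∀ x, 0 < x → M.u x ≠ ⊥
  zero_le : ∀ x, 0 < x → M.u 0 ≤ M.u x
  differentiableAt : ∀ x : ℝ, 0 < x → DifferentiableAt ℝ M.uReal x
  differentiableAt_deriv : ∀ x : ℝ, 0 < x → DifferentiableAt ℝ M.u' x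
  deriv_pos : ∀ x : ℝ, 0 < x → 0 < M.u' x
  deriv2_neg : ∀ x : ℝ, 0 < x → deriv M.u' x < 0
  tendsto_zero : Tendsto M.u' (𝓝[>] 0) atTop
  tendsto_atTop : Tendsto M.u' atTop (𝓝 0)

/-- The law of one period's shocks `(z_t, ζ_t, η_t)`. -/
def shock (M : IncomeFluctuation Z E F) : Measure (Z × E × F) :=
  M.lawZ.prod (M.lawζ.prod M.lawη)

instance (M : IncomeFluctuation Z E F) : IsProbabilityMeasure M.shock := by
  have := M.isProb_lawZ
  have := M.isProb_lawζ
  have := M.isProb_lawη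
  unfold shock
  infer_instance

/-- The return in a period with shocks `w = (z, ζ, η)`. -/
def ret (M : IncomeFluctuation Z E F) (w : Z × E × F) : ℝ≥0 := M.R (w.1, w.2.1)

/-- The labour income in a period with shocks `w = (z, ζ, η)`. -/
def inc (M : IncomeFluctuation Z E F) (w : Z × E × F) : ℝ≥0 := M.Y (w.1, w.2.2)

/-- The law of the whole sequence of shocks; coordinate `t` of `ω : ℕ → Z × E × F` is
`(z_{t+1}, ζ_{t+1}, η_{t+1})`. The law does not depend on `z_0`, so `𝔼_z` is the expectation
under this measure, with `z_0 = z` put in by hand where it enters. -/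
def pathLaw (M : IncomeFluctuation Z E F) : Measure (ℕ → Z × E × F) :=
  Measure.infinitePi fun _ => M.shock

/-- `𝔼 R_1 ⋯ R_n`. -/
def expProdRet (M : IncomeFluctuation Z E F) (n : ℕ) : ℝ≥0∞ :=
  ∫⁻ ω, ∏ t ∈ Finset.range n, (M.ret (ω t) : ℝ≥0∞) ∂M.pathLaw

/-- `𝔼 Y_{t+1}`. -/
def expInc (M : IncomeFluctuation Z E F) (t : ℕ) : ℝ≥0∞ :=
  ∫⁻ ω, (M.inc (ω t) : ℝ≥0∞) ∂M.pathLaw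

/-- There is `n` with `β ^ n 𝔼 R_1 ⋯ R_n < 1`. -/
def ContractionAssumption (M : IncomeFluctuation Z E F) : Prop :=
  ∃ n : ℕ, (M.β : ℝ≥0∞) ^ n * M.expProdRet n < 1

/-- `∑_{t ≥ 1} β ^ t 𝔼 Y_t < ∞`. -/
def IncomeSumAssumption (M : IncomeFluctuation Z E F) : Prop :=
  (∑' t : ℕ, (M.β : ℝ≥0∞) ^ (t + 1) * M.expInc t) < ⊤

/-- `𝔼 R`, `𝔼 u'(Y)` and `𝔼 R u'(Y)` are finite. -/
def MomentAssumption (M : IncomeFluctuation Z E F) : Prop :=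
  (∫⁻ w, (M.ret w : ℝ≥0∞) ∂M.shock) < ⊤ ∧
  (∫⁻ w, M.marg (M.inc w) ∂M.shock) < ⊤ ∧
  (∫⁻ w, (M.ret w : ℝ≥0∞) * M.marg (M.inc w) ∂M.shock) < ⊤

/-- Continuity of `R` and `Y` in the exogenous state. (The further requirement that `𝔼_z R` and
`𝔼_z R u'(Y)` be continuous in `z` is void here: they do not depend on `z`.) -/
def ContinuityAssumption [TopologicalSpace Z] (M : IncomeFluctuation Z E F) : Prop :=
  (∀ ζ, Continuous fun z => M.R (z, ζ)) ∧ ∀ η, Continuous fun z => M.Y (z, η)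

/-- There is `α ∈ (0, 1)` with `β 𝔼 R u'(R (1 - α) a) ≤ u'(a)` for all `a > 0` and
`(1 - α) ^ n 𝔼 R_1 ⋯ R_n < 1` for some `n`. -/
def SavingAssumption (M : IncomeFluctuation Z E F) : Prop :=
  ∃ α : ℝ≥0, 0 < α ∧ α < 1 ∧
    (∀ a : ℝ≥0, 0 < a →
      (M.β : ℝ≥0∞) * ∫⁻ w, (M.ret w : ℝ≥0∞) * M.marg (M.ret w * (1 - α) * a) ∂M.shock
        ≤ M.marg a) ∧
    ∃ n : ℕ, ((1 - α : ℝ≥0) : ℝ≥0∞) ^ n * M.expProdRet n < 1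

/-- `sup_{t ≥ 1} 𝔼 Y_t < ∞`. -/
def IncomeBoundAssumption (M : IncomeFluctuation Z E F) : Prop :=
  (⨆ t : ℕ, M.expInc t) < ⊤

/-- A feasible policy: a Borel function `c` with `0 ≤ c(a, z) ≤ a`. Policies are functions on
`[0, ∞) × Z`; the inequality forces `c(0, z) = 0`, so this is the same as a policy on
`(0, ∞) × Z` extended by zero. -/
structure Feasible (c : ℝ≥0 × Z → ℝ≥0) : Prop where
  measurable : Measurable c
  le : ∀ a z, c (a, z) ≤ a

/-- The class `𝒞` of candidate policies. -/
structure Candidate [TopologicalSpace Z] (M : IncomeFluctuation Z E F)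
    (c : ℝ≥0 × Z → ℝ≥0) : Prop where
  continuousOn : ContinuousOn c {s | 0 < s.1}
  mono : ∀ (a b : ℝ≥0) (z : Z), 0 < a → a ≤ b → c (a, z) ≤ c (b, z)
  pos : ∀ (a : ℝ≥0) (z : Z), 0 < a → 0 < c (a, z)
  le : ∀ (a : ℝ≥0) (z : Z), c (a, z) ≤ a
  bounded : ∃ K : ℝ, ∀ (a : ℝ≥0) (z : Z), 0 < a → |M.u' (c (a, z)) - M.u' a| ≤ K

/-- The inverse of `u' : (0, ∞) → (0, ∞)`. -/
def u'Inv (M : IncomeFluctuation Z E F) (y : ℝ) : ℝ :=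
  Function.invFunOn M.u' (Ioi 0) y

/-- For each candidate policy `c` that is concave in wealth, the map
`s ↦ (u')⁻¹ [β 𝔼 R (u' ∘ c)(R s + Y, z)]` is concave on `[0, ∞)`. The expectation is finite; it
vanishes only if `β = 0` or `R = 0` almost surely, when it does so for every `s` and the
condition holds trivially. -/
def ConcavityAssumption [TopologicalSpace Z] (M : IncomeFluctuation Z E F) : Prop :=
  ∀ c : ℝ≥0 × Z → ℝ≥0, M.Candidate c →
    (∀ z, ConcaveOn ℝ (Ioi 0) fun a : ℝ => (c (a.toNNReal, z) : ℝ)) →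
    ConcaveOn ℝ (Ici 0) fun s : ℝ =>
      M.u'Inv ((M.β : ℝ≥0∞) * ∫⁻ w, (M.ret w : ℝ≥0∞) *
        M.marg (c (M.ret w * s.toNNReal + M.inc w, w.1)) ∂M.shock).toReal

/-- Next period's wealth, when `b` is saved and the shocks are `w`. -/
def nextWealth (M : IncomeFluctuation Z E F) (b : ℝ≥0) (w : Z × E × F) : ℝ≥0 :=
  M.ret w * b + M.inc w

/-- The state `(a_t, z_t)` under the policy `c`, started at `(a, z)`. -/
def statePath (M : IncomeFluctuation Z E F) (c : ℝ≥0 × Z → ℝ≥0) (a : ℝ≥0) (z : Z)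
    (ω : ℕ → Z × E × F) : ℕ → ℝ≥0 × Z
  | 0 => (a, z)
  | t + 1 =>
    (M.nextWealth ((M.statePath c a z ω t).1 - c (M.statePath c a z ω t)) (ω t), (ω t).1)

/-- Lifetime value `V_c(a, z) = 𝔼_{a,z} ∑_t β ^ t u(c(a_t, z_t))`, as the expected discounted sum
of the positive parts minus that of the negative parts. -/
def lifetimeValue (M : IncomeFluctuation Z E F) (c : ℝ≥0 × Z → ℝ≥0) (a : ℝ≥0) (z : Z) : EReal :=
  ((∫⁻ ω, ∑' t : ℕ, (M.β : ℝ≥0∞) ^ t * (M.u (c (M.statePath c a z ω t))).toENNReal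
      ∂M.pathLaw : ℝ≥0∞) : EReal) -
  ((∫⁻ ω, ∑' t : ℕ, (M.β : ℝ≥0∞) ^ t * (-M.u (c (M.statePath c a z ω t))).toENNReal
      ∂M.pathLaw : ℝ≥0∞) : EReal)

/-- A feasible policy is optimal if no feasible policy has a larger lifetime value at any
`(a, z)` with `a > 0`. -/
def Optimal (M : IncomeFluctuation Z E F) (c : ℝ≥0 × Z → ℝ≥0) : Prop :=
  Feasible c ∧ ∀ d : ℝ≥0 × Z → ℝ≥0, Feasible d →
    ∀ (a : ℝ≥0) (z : Z), 0 < a → M.lifetimeValue d a z ≤ M.lifetimeValue c a z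

/-- The kernel of the wealth process `a_{t+1} = R_{t+1} (a_t - c(a_t)) + Y_{t+1}` on `[0, ∞)`:
`Q(a, ·)` is the law of `R (a - c(a)) + Y`, for measurable `c`. -/
def wealthKernel (M : IncomeFluctuation Z E F) (c : ℝ≥0 → ℝ≥0) : Kernel ℝ≥0 ℝ≥0 :=
  (Kernel.id ×ₖ Kernel.const ℝ≥0 M.shock).map fun p => M.nextWealth (p.1 - c p.1) p.2

end

end IncomeFluctuation

/-- Global stability of a kernel `Q`: it has a unique stationary distribution `ψ`, and `ψ₀ Q ^ t`
converges weakly to `ψ` for every initial distribution `ψ₀`. Powers of kernels are those of the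
composition monoid. -/
def GloballyStable {S : Type*} [TopologicalSpace S] [MeasurableSpace S] (Q : Kernel S S) : Prop :=
  ∃ ψ : Measure S, IsProbabilityMeasure ψ ∧ ψ.bind Q = ψ ∧
    (∀ φ : Measure S, IsProbabilityMeasure φ → φ.bind Q = φ → φ = ψ) ∧
    ∀ ψ₀ : Measure S, IsProbabilityMeasure ψ₀ → ∀ h : S →ᵇ ℝ,
      Tendsto (fun t : ℕ => ∫ x, h x ∂(ψ₀.bind (Q ^ t : Kernel S S))) atTop (𝓝 (∫ x, h x ∂ψ))

/-! Since the shocks are iid, `𝔼 R_1 ⋯ R_n = (𝔼 R)^n`, so the two n-step conditions reduce to `β 𝔼 R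
< 1` and `(1 - α) 𝔼 R < 1`, and a policy can be sought among functions of wealth alone.

Existence of an Euler policy. Time iteration is monotone and preserves the class of increasing,
1-Lipschitz `c` with `α a ≤ c(a) ≤ a` and `u'(c(a)) ≤ u'(a) + κ` (`wealthPolicy_timeIter`), as well
as concavity. Started at the identity it decreases; the class is closed under pointwise limits and
`R (u'(Y) + κ)` dominates all integrands, so the limit is a concave fixed point
(`timeIter_limitPolicy`), i.e. it satisfies the Euler equation. No contraction argument is needed.

Optimality. Use `p_t = u'(c(a_t))` as a shadow price. Concavity of `u` gives `u(d_t) - u(c_t) ≤ p_t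
(d_t - c_t)`, and the Euler equation makes the discounted right-hand sides telescope in expected
priced wealth (`priced_step`). The boundary term vanishes because discounted priced wealth is
summable. The tangent inequality is strict where consumption differs, so a policy that differs from
`c` at a state does strictly worse there (`lifetimeValue_le`), which gives uniqueness.

Stability. A concave `c` with `c(a) ≥ α a` has all slopes at least `α`, so `a ↦ R (a - c(a)) + Y` is
Lipschitz with constant `R (1 - α)`, of mean less than one. Composed with the newest shock
innermost, these maps converge almost surely to a limit free of the starting point
(`exists_backward_limit`). Backward and forward compositions agree in law at each fixed time, so the
law of that limit attracts every initial distribution. -/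

namespace IncomeFluctuation

noncomputable section

variable {Z E F : Type*} [MeasurableSpace Z] [MeasurableSpace E] [MeasurableSpace F]

/-! ### Utility and marginal utility -/

section Utility

variable {M : IncomeFluctuation Z E F}

namespace UtilityAssumption

lemma strictAntiOn_u' (hu : M.UtilityAssumption) : StrictAntiOn M.u' (Ioi 0) :=
  strictAntiOn_of_deriv_neg (convex_Ioi 0)
    (fun x hx => (hu.differentiableAt_deriv x hx).continuousAt.continuousWithinAt)
    (fun x hx => hu.deriv2_neg x (by simpa using hx))

lemma u'_le_u'_iff (hu : M.UtilityAssumption) {x y : ℝ} (hx : 0 < x) (hy : 0 < y) :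
    M.u' x ≤ M.u' y ↔ y ≤ x :=
  hu.strictAntiOn_u'.le_iff_ge hx hy

lemma strictMonoOn_uReal (hu : M.UtilityAssumption) : StrictMonoOn M.uReal (Ioi 0) :=
  strictMonoOn_of_deriv_pos (convex_Ioi 0)
    (fun x hx => (hu.differentiableAt x hx).continuousAt.continuousWithinAt)
    (fun x hx => hu.deriv_pos x (by simpa using hx))

lemma u_eq_uReal (hu : M.UtilityAssumption) {x : ℝ≥0} (hx : 0 < x) :
    M.u x = ((M.uReal x : ℝ) : EReal) := by
  rw [uReal, Real.toNNReal_coe, EReal.coe_toReal (hu.ne_top x) (hu.ne_bot x hx)]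

lemma monotone_u (hu : M.UtilityAssumption) : Monotone M.u := by
  intro x y hxy
  rcases eq_zero_or_pos x with rfl | hx
  · rcases eq_zero_or_pos y with rfl | hy
    · exact le_rfl
    · exact hu.zero_le y hy
  · have hy := hx.trans_le hxy
    rw [hu.u_eq_uReal hx, hu.u_eq_uReal hy, EReal.coe_le_coe_iff]
    exact hu.strictMonoOn_uReal.monotoneOn (show (0 : ℝ) < x from hx)
      (show (0 : ℝ) < y from hy) hxy

/-- The graph of the utility function lies strictly below its tangents. -/
lemma uReal_lt_tangent (hu : M.UtilityAssumption) {c d : ℝ} (hc : 0 < c) (hd : 0 < d)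
    (h : d ≠ c) : M.uReal d < M.uReal c + M.u' c * (d - c) := by
  have hcont : ∀ x : ℝ, 0 < x → ContinuousAt M.uReal x :=
    fun x hx => (hu.differentiableAt x hx).continuousAt
  rcases lt_or_gt_of_ne h with h | h
  · obtain ⟨ξ, hξ, e⟩ := exists_deriv_eq_slope M.uReal h
      (fun x hx => (hcont x (hd.trans_le hx.1)).continuousWithinAt)
      (fun x hx => (hu.differentiableAt x (hd.trans hx.1)).differentiableWithinAt)
    have h1 : M.u' c < M.u' ξ := hu.strictAntiOn_u' (hd.trans hξ.1) hc hξ.2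
    change M.u' ξ = _ at e
    rw [e, lt_div_iff₀ (by linarith)] at h1
    linarith
  · obtain ⟨ξ, hξ, e⟩ := exists_deriv_eq_slope M.uReal h
      (fun x hx => (hcont x (hc.trans_le hx.1)).continuousWithinAt)
      (fun x hx => (hu.differentiableAt x (hc.trans hx.1)).differentiableWithinAt)
    have h1 : M.u' ξ < M.u' c := hu.strictAntiOn_u' hc (hc.trans hξ.1) hξ.1
    change M.u' ξ = _ at e
    rw [e, div_lt_iff₀ (by linarith)] at h1
    linarith

lemma uReal_le_tangent (hu : M.UtilityAssumption) {c d : ℝ} (hc : 0 < c) (hd : 0 < d) :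
    M.uReal d ≤ M.uReal c + M.u' c * (d - c) := by
  rcases eq_or_ne d c with rfl | h
  · simp
  · exact (hu.uReal_lt_tangent hc hd h).le

/-- The tangent bound at zero consumption. -/
lemma zero_lt_tangent (hu : M.UtilityAssumption) {c r : ℝ} (hc : 0 < c)
    (hr : M.u 0 = (r : EReal)) : r < M.uReal c - M.u' c * c := by
  have h1 : ∀ x : ℝ, 0 < x → r ≤ M.uReal x := by
    intro x hx
    have h := hu.zero_le x.toNNReal (by simpa using hx)
    rw [hr, hu.u_eq_uReal (by simpa using hx), EReal.coe_le_coe_iff, Real.coe_toNNReal x hx.le] at h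
    exact h
  -- The limit at zero only yields a weak inequality. Strictness is recovered through the midpoint:
  -- the tangent at `c / 2` is pushed to zero, and the tangent at `c` is compared strictly at `c /
  -- 2`.
  have hc2 : 0 < c / 2 := by linarith
  have h2 : r ≤ M.uReal (c / 2) - M.u' (c / 2) * (c / 2) := by
    have ht : Tendsto (fun x : ℝ => M.uReal (c / 2) + M.u' (c / 2) * (x - c / 2)) (𝓝[>] 0)
        (𝓝 (M.uReal (c / 2) + M.u' (c / 2) * (0 - c / 2))) :=
      (Continuous.tendsto (by fun_prop) 0).mono_left nhdsWithin_le_nhds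
    have := ge_of_tendsto ht (eventually_nhdsWithin_of_forall fun x hx =>
      (h1 x hx).trans (hu.uReal_le_tangent hc2 hx))
    linarith
  have h3 := hu.uReal_lt_tangent hc hc2 (by linarith)
  have h4 : M.u' c < M.u' (c / 2) := hu.strictAntiOn_u' hc2 hc (by linarith)
  nlinarith

lemma exists_u'_eq (hu : M.UtilityAssumption) {y : ℝ} (hy : 0 < y) :
    ∃ x ∈ Ioi (0 : ℝ), M.u' x = y := by
  have hc : ContinuousOn M.u' (Ioi 0) :=
    fun x hx => (hu.differentiableAt_deriv x hx).continuousAt.continuousWithinAt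
  obtain ⟨b, hb0, hb⟩ := ((eventually_gt_atTop 0).and
    (hu.tendsto_atTop.eventually_lt_const hy)).exists
  obtain ⟨a, ha0, ha⟩ := ((eventually_mem_nhdsWithin).and
    (hu.tendsto_zero.eventually_ge_atTop y)).exists
  exact isPreconnected_Ioi.intermediate_value hb0 ha0 hc ⟨hb.le, ha⟩

lemma u'Inv_pos (hu : M.UtilityAssumption) {y : ℝ} (hy : 0 < y) : 0 < M.u'Inv y :=
  Function.invFunOn_mem (hu.exists_u'_eq hy)

lemma u'_u'Inv (hu : M.UtilityAssumption) {y : ℝ} (hy : 0 < y) : M.u' (M.u'Inv y) = y :=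
  Function.invFunOn_eq (hu.exists_u'_eq hy)

end UtilityAssumption

/-! ### Extended-valued marginal utility and tangent inequalities -/

lemma marg_zero (M : IncomeFluctuation Z E F) : M.marg 0 = ⊤ := if_pos rfl

lemma marg_of_pos (M : IncomeFluctuation Z E F) {x : ℝ≥0} (hx : 0 < x) :
    M.marg x = ENNReal.ofReal (M.u' x) := if_neg hx.ne'

namespace UtilityAssumption

lemma marg_ne_top (_ : M.UtilityAssumption) {x : ℝ≥0} (hx : 0 < x) : M.marg x ≠ ⊤ := by
  rw [M.marg_of_pos hx]; exact ENNReal.ofReal_ne_top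

lemma marg_pos (hu : M.UtilityAssumption) (x : ℝ≥0) : 0 < M.marg x := by
  rcases eq_zero_or_pos x with rfl | hx
  · simp [marg_zero]
  · rw [M.marg_of_pos hx]; exact ENNReal.ofReal_pos.2 (hu.deriv_pos x hx)

lemma strictAnti_marg (hu : M.UtilityAssumption) : StrictAnti M.marg := by
  intro x y hxy
  rcases eq_zero_or_pos x with rfl | hx
  · rw [marg_zero]; exact (hu.marg_ne_top hxy).lt_top
  · have hy := hx.trans hxy
    rw [M.marg_of_pos hx, M.marg_of_pos hy]
    exact (ENNReal.ofReal_lt_ofReal_iff (hu.deriv_pos x hx)).2 (hu.strictAntiOn_u' hx hy hxy)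

lemma antitone_marg (hu : M.UtilityAssumption) : Antitone M.marg := hu.strictAnti_marg.antitone

/-- Continuity at zero is the condition `u'(0+) = ∞`, read in `ℝ≥0∞`. It spares the later limits any
case distinction at zero. -/
lemma continuous_marg (hu : M.UtilityAssumption) : Continuous M.marg := by
  rw [continuous_iff_continuousAt]
  intro x
  rcases eq_zero_or_pos x with rfl | hx
  · rw [ContinuousAt, marg_zero, ENNReal.tendsto_nhds_top_iff_nnreal]
    intro K
    have h := hu.tendsto_zero.eventually_gt_atTop (K : ℝ)
    rw [eventually_nhdsWithin_iff] at h
    have h2 := (NNReal.continuous_coe.tendsto 0).eventually h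
    filter_upwards [h2] with y hy
    rcases eq_zero_or_pos y with rfl | hy0
    · simp [marg_zero]
    · rw [M.marg_of_pos hy0, ← ENNReal.ofReal_coe_nnreal]
      have := hy hy0
      exact (ENNReal.ofReal_lt_ofReal_iff (K.coe_nonneg.trans_lt this)).2 this
  · have h : ContinuousAt (fun y : ℝ≥0 => ENNReal.ofReal (M.u' y)) x :=
      ENNReal.continuous_ofReal.continuousAt.comp
        (ContinuousAt.comp (f := fun y : ℝ≥0 => (y : ℝ))
          (hu.differentiableAt_deriv x hx).continuousAt NNReal.continuous_coe.continuousAt)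
    refine h.congr ?_
    filter_upwards [lt_mem_nhds hx] with y hy
    rw [M.marg_of_pos hy]

lemma measurable_marg (hu : M.UtilityAssumption) : Measurable M.marg :=
  hu.continuous_marg.measurable

lemma measurable_u (hu : M.UtilityAssumption) : Measurable M.u := hu.monotone_u.measurable

/-- The strict tangent inequality, arranged so that all terms are nonnegative. -/
lemma tangent_ennreal_strict (hu : M.UtilityAssumption) {c d : ℝ≥0} (hc : 0 < c) (h : d ≠ c) :
    ∃ δ : ℝ≥0∞, 0 < δ ∧ (M.u d).toENNReal + (-M.u c).toENNReal + M.marg c * c + δ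
      ≤ (M.u c).toENNReal + (-M.u d).toENNReal + M.marg c * d := by
  have key : ∀ r : ℝ, M.u d = (r : EReal) → r < M.uReal c + M.u' c * (d - c) →
      ∃ δ : ℝ≥0∞, 0 < δ ∧ (M.u d).toENNReal + (-M.u c).toENNReal + M.marg c * c + δ
      ≤ (M.u c).toENNReal + (-M.u d).toENNReal + M.marg c * d := by
    intro r hr hlt
    have hp := (hu.deriv_pos c hc).le
    refine ⟨ENNReal.ofReal (M.uReal c + M.u' c * (d - c) - r),
      ENNReal.ofReal_pos.2 (by linarith), ?_⟩
    -- Positive minus negative part recovers `x`, which turns the rearranged inequality back into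
    -- the real tangent inequality.
    have e : ∀ x : ℝ, max x 0 - max (-x) 0 = x := by
      intro x
      rcases le_total x 0 with hx | hx
      · rw [max_eq_right hx, max_eq_left (by linarith)]; ring
      · rw [max_eq_left hx, max_eq_right (by linarith)]; ring
    have h1 : ∀ x : ℝ, ((x : EReal)).toENNReal = ENNReal.ofReal (max x 0) := by
      intro x
      rw [EReal.toENNReal_of_ne_top (EReal.coe_ne_top x), EReal.toReal_coe]
      rcases le_total x 0 with hx | hx
      · rw [max_eq_right hx, ENNReal.ofReal_of_nonpos hx, ENNReal.ofReal_zero]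
      · rw [max_eq_left hx]
    rw [hr, hu.u_eq_uReal hc, ← EReal.coe_neg, ← EReal.coe_neg, h1, h1, h1, h1, M.marg_of_pos hc,
      ← ENNReal.ofReal_coe_nnreal, ← ENNReal.ofReal_coe_nnreal, ← ENNReal.ofReal_mul hp,
      ← ENNReal.ofReal_mul hp, ← ENNReal.ofReal_add, ← ENNReal.ofReal_add, ← ENNReal.ofReal_add,
      ← ENNReal.ofReal_add, ← ENNReal.ofReal_add]
    · apply ENNReal.ofReal_le_ofReal
      have := e r
      have := e (M.uReal c)
      linarith
    all_goals positivity
  rcases eq_zero_or_pos d with rfl | hd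
  · by_cases hb : M.u 0 = ⊥
    -- If `u(0) = -∞`, the negative part of `u(d)` makes the right-hand side infinite, so any slack
    -- will do.
    · exact ⟨1, one_pos, by rw [hb]; simp⟩
    · have hr : M.u 0 = ((M.u 0).toReal : EReal) := (EReal.coe_toReal (hu.ne_top 0) hb).symm
      refine key _ hr ?_
      have := hu.zero_lt_tangent hc hr
      rwa [NNReal.coe_zero, zero_sub, mul_neg, ← sub_eq_add_neg]
  · exact key _ (hu.u_eq_uReal hd) (hu.uReal_lt_tangent hc hd (by exact_mod_cast h))

/-- Holds also at `c = 0`, where `u'(0) = ∞` makes the right-hand side infinite unless `d = 0`; it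
can thus be integrated without excluding null sets. -/
lemma tangent_ennreal (hu : M.UtilityAssumption) (c d : ℝ≥0) :
    (M.u d).toENNReal + (-M.u c).toENNReal + M.marg c * c
      ≤ (M.u c).toENNReal + (-M.u d).toENNReal + M.marg c * d := by
  rcases eq_or_ne d c with rfl | h
  · rfl
  rcases eq_zero_or_pos c with rfl | hc
  · have hd : (d : ℝ≥0∞) ≠ 0 := by simpa using h
    rw [marg_zero, ENNReal.top_mul hd, add_top]
    exact le_top
  · obtain ⟨δ, -, hδ⟩ := hu.tangent_ennreal_strict hc h
    exact le_self_add.trans hδ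

/-- Tangent at 1: gains from utility grow at most linearly in consumption, hence in wealth. -/
lemma toENNReal_u_le (hu : M.UtilityAssumption) (x : ℝ≥0) :
    (M.u x).toENNReal ≤ (M.u 1).toENNReal + M.marg 1 * x := by
  rcases le_total (M.u x) 0 with h | h
  · rw [EReal.toENNReal_of_nonpos h]; exact bot_le
  · have h1 := hu.tangent_ennreal 1 x
    rw [EReal.toENNReal_of_nonpos (x := -M.u x) (by simpa using h), add_zero, add_assoc] at h1
    exact le_self_add.trans h1

/-- Tangent at `x`, evaluated at 1: losses are controlled by marginal utility, whose moments are
controlled. -/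
lemma toENNReal_neg_u_le (hu : M.UtilityAssumption) (x : ℝ≥0) :
    (-M.u x).toENNReal ≤ (-M.u 1).toENNReal + M.marg x := by
  rcases le_total 0 (M.u x) with h | h
  · rw [EReal.toENNReal_of_nonpos (by simpa using h)]; exact bot_le
  · have h1 := hu.tangent_ennreal x 1
    rw [EReal.toENNReal_of_nonpos h, zero_add, ENNReal.coe_one, mul_one] at h1
    exact (le_add_self.trans le_self_add).trans h1

/-- Compare `x` with 1. This makes `𝔼 u'(Y) Y` finite, which is not among the moment assumptions. -/
lemma marg_mul_self_le (hu : M.UtilityAssumption) (x : ℝ≥0) :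
    M.marg x * x ≤ M.marg x + M.marg 1 * x := by
  rcases le_total x 1 with h | h
  · calc M.marg x * x ≤ M.marg x * 1 := by gcongr; exact_mod_cast h
      _ ≤ _ := by simp
  · exact le_add_left (mul_le_mul_left (hu.antitone_marg h) _)

end UtilityAssumption

end Utility

/-! ### The law of the shocks -/

section PathLaw

variable (M : IncomeFluctuation Z E F)

instance : IsProbabilityMeasure M.pathLaw := by
  unfold pathLaw
  infer_instance

lemma measurable_ret : Measurable M.ret :=
  M.measurable_R.comp (measurable_fst.prodMk (measurable_fst.comp measurable_snd))

lemma measurable_inc : Measurable M.inc :=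
  M.measurable_Y.comp (measurable_fst.prodMk (measurable_snd.comp measurable_snd))

/-- `𝔼 R`. -/
def meanRet : ℝ≥0∞ := ∫⁻ w, (M.ret w : ℝ≥0∞) ∂M.shock

/-- `𝔼 Y`. -/
def meanInc : ℝ≥0∞ := ∫⁻ w, (M.inc w : ℝ≥0∞) ∂M.shock

/-- The shock of period `t` is independent of any function of the earlier shocks. -/
lemma lintegral_pathLaw_eq {S : Type*} [MeasurableSpace S] {f : (ℕ → Z × E × F) → S} {t : ℕ}
    (hf : Measurable f) (hdep : ∀ ω ω', (∀ i < t, ω i = ω' i) → f ω = f ω')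
    {G : S → Z × E × F → ℝ≥0∞} (hG : Measurable (Function.uncurry G)) :
    ∫⁻ ω, G (f ω) (ω t) ∂M.pathLaw = ∫⁻ ω, ∫⁻ w, G (f ω) w ∂M.shock ∂M.pathLaw := by
  obtain ⟨w₀⟩ : Nonempty (Z × E × F) := M.shock.nonempty_of_neZero
  let ext : (Finset.range t → Z × E × F) → ℕ → Z × E × F :=
    fun v i => if h : i ∈ Finset.range t then v ⟨i, h⟩ else w₀
  have hext : Measurable ext := by
    refine measurable_pi_lambda _ fun i => ?_
    by_cases h : i ∈ Finset.range t
    · simpa only [ext, h, dite_true] using measurable_pi_apply _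
    · simp only [ext, h, dite_false]; exact measurable_const
  -- `f` factors through the first `t` coordinates, so independence of disjoint blocks of
  -- coordinates applies.
  have hfe : f = fun ω => (f ∘ ext) fun i : Finset.range t => ω i := by
    funext ω
    refine hdep _ _ fun i hi => ?_
    simp [ext, hi]
  have hind : iIndepFun (fun (i : ℕ) (ω : ℕ → Z × E × F) => ω i) M.pathLaw :=
    iIndepFun_infinitePi (X := fun _ w => w) (fun _ => measurable_id)
  have hft : IndepFun f (fun ω : ℕ → Z × E × F => ω t) M.pathLaw := by
    have h := hind.indepFun_finset (Finset.range t) {t} (by simp) (fun i => measurable_pi_apply i)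
    have h2 := h.comp (hf.comp hext)
      (measurable_pi_apply (⟨t, Finset.mem_singleton_self t⟩ : ({t} : Finset ℕ)))
    rw [hfe]
    exact h2
  have hmap : M.pathLaw.map (fun ω : ℕ → Z × E × F => ω t) = M.shock :=
    Measure.infinitePi_map_eval _ t
  have hpair := (indepFun_iff_map_prod_eq_prod_map_map hf.aemeasurable
    (measurable_pi_apply t).aemeasurable).1 hft
  rw [hmap] at hpair
  calc ∫⁻ ω, G (f ω) (ω t) ∂M.pathLaw
      = ∫⁻ p, Function.uncurry G p ∂(M.pathLaw.map fun ω => (f ω, ω t)) :=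
        (lintegral_map hG (hf.prodMk (measurable_pi_apply t))).symm
    _ = ∫⁻ s, ∫⁻ w, G s w ∂M.shock ∂(M.pathLaw.map f) := by
        rw [hpair, lintegral_prod _ hG.aemeasurable]; rfl
    _ = _ := lintegral_map hG.lintegral_prod_right' hf

/-- Truncation of a shock sequence, a measurable function of the first `t` shocks. -/
def truncate (w₀ : Z × E × F) (t : ℕ) (ω : ℕ → Z × E × F) (i : ℕ) : Z × E × F :=
  if i < t then ω i else w₀

lemma measurable_truncate (w₀ : Z × E × F) (t : ℕ) : Measurable (truncate w₀ t) := by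
  refine measurable_pi_lambda _ fun i => ?_
  by_cases h : i < t
  · simpa only [truncate, h, if_true] using measurable_pi_apply i
  · simp only [truncate, h, if_false]; exact measurable_const

/-- The shock of period `t` may be integrated out after the earlier shocks. -/
lemma lintegral_pathLaw_swap (t : ℕ)
    {G : ((ℕ → Z × E × F) × (Z × E × F)) → ℝ≥0∞} (hG : Measurable G)
    (hdep : ∀ ω ω' w, (∀ i < t, ω i = ω' i) → G (ω, w) = G (ω', w)) :
    ∫⁻ ω, G (ω, ω t) ∂M.pathLaw = ∫⁻ w, ∫⁻ ω, G (ω, w) ∂M.pathLaw ∂M.shock := by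
  obtain ⟨w₀⟩ : Nonempty (Z × E × F) := M.shock.nonempty_of_neZero
  have htr : ∀ ω w, G (truncate w₀ t ω, w) = G (ω, w) := fun ω w =>
    hdep _ _ w fun i hi => by simp [truncate, hi]
  have h := M.lintegral_pathLaw_eq (t := t) (measurable_truncate w₀ t)
    (fun ω ω' h => by
      funext i
      by_cases hi : i < t
      · simp [truncate, hi, h i hi]
      · simp [truncate, hi])
    (G := fun ω w => G (ω, w)) hG
  simp only [htr] at h
  rw [h]
  exact lintegral_lintegral_swap hG.aemeasurable

lemma lintegral_pathLaw_eval {G : Z × E × F → ℝ≥0∞} (hG : Measurable G) (t : ℕ) :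
    ∫⁻ ω, G (ω t) ∂M.pathLaw = ∫⁻ w, G w ∂M.shock := by
  have := M.lintegral_pathLaw_eq (f := fun _ => ()) (t := t) measurable_const (fun _ _ _ => rfl)
    (G := fun _ w => G w) (hG.comp measurable_snd)
  simpa using this

lemma expInc_eq (t : ℕ) : M.expInc t = M.meanInc :=
  M.lintegral_pathLaw_eval (G := fun w => (M.inc w : ℝ≥0∞)) M.measurable_inc.coe_nnreal_ennreal t

lemma expProdRet_eq (n : ℕ) : M.expProdRet n = M.meanRet ^ n := by
  induction n with
  | zero => simp [expProdRet]
  | succ n ih =>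
    have hm : ∀ n, Measurable fun ω : ℕ → Z × E × F =>
        ∏ t ∈ Finset.range n, (M.ret (ω t) : ℝ≥0∞) := fun n =>
      Finset.measurable_prod _ fun t _ =>
        (M.measurable_ret.comp (measurable_pi_apply t)).coe_nnreal_ennreal
    have h := M.lintegral_pathLaw_eq (t := n) (hm n)
      (fun ω ω' h => Finset.prod_congr rfl fun i hi => by rw [h i (Finset.mem_range.1 hi)])
      (G := fun p w => p * (M.ret w : ℝ≥0∞))
      (measurable_fst.mul (M.measurable_ret.comp measurable_snd).coe_nnreal_ennreal)
    rw [expProdRet, pow_succ, ← ih, expProdRet]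
    simp only [Finset.prod_range_succ]
    rw [h, ← lintegral_mul_const _ (hm n)]
    refine lintegral_congr fun ω => ?_
    rw [lintegral_const_mul _ M.measurable_ret.coe_nnreal_ennreal, meanRet]

variable {M}

/-- By independence the n-step quantity is the n-th power of the one-step quantity, and a power
below one has its base below one. -/
lemma mul_meanRet_lt_one_of_pow {x : ℝ≥0∞} (h : ∃ n : ℕ, x ^ n * M.expProdRet n < 1) :
    x * M.meanRet < 1 := by
  obtain ⟨n, hn⟩ := h
  rw [expProdRet_eq, ← mul_pow] at hn
  by_contra! hc
  exact hn.not_ge (one_le_pow₀ hc)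

lemma IncomeBoundAssumption.meanInc_ne_top (h : M.IncomeBoundAssumption) : M.meanInc ≠ ⊤ := by
  have h' : (⨆ t : ℕ, M.expInc t) < ⊤ := h
  rw [← M.expInc_eq 0]
  exact ((le_iSup M.expInc 0).trans_lt h').ne

end PathLaw

/-! ### The time iteration operator -/

section Operator

/-- Take the fixed point `A / (1 - θ)` of `κ ↦ A + θ κ`. -/
lemma exists_add_mul_le {A θ : ℝ≥0∞} (hA : A ≠ ⊤) (hθ : θ < 1) :
    ∃ κ : ℝ≥0, A + θ * κ ≤ κ := by
  lift θ to ℝ≥0 using (hθ.trans ENNReal.one_lt_top).ne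
  lift A to ℝ≥0 using hA
  have h1 : θ < 1 := by exact_mod_cast hθ
  refine ⟨A / (1 - θ), ?_⟩
  norm_cast
  have h2 : (1 - θ) * (A / (1 - θ)) = A := mul_div_cancel₀ _ (tsub_pos_of_lt h1).ne'
  nth_rewrite 1 [← h2]
  rw [← add_mul, tsub_add_cancel_of_le h1.le, one_mul]

variable (M : IncomeFluctuation Z E F)

/-- The discounted expected marginal value `β 𝔼 R u'(c(R s + Y))` of saving `s`. -/
def savingValue (c : ℝ≥0 → ℝ≥0) (s : ℝ≥0) : ℝ≥0∞ :=
  (M.β : ℝ≥0∞) * ∫⁻ w, (M.ret w : ℝ≥0∞) * M.marg (c (M.nextWealth s w)) ∂M.shock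

/-- The time iteration operator: `timeIter c a` is the largest consumption `ξ ≤ a` with
`β 𝔼 R u'(c(R (a - ξ) + Y)) ≤ u'(ξ)`. -/
def timeIter (c : ℝ≥0 → ℝ≥0) (a : ℝ≥0) : ℝ≥0 :=
  sSup {ξ | ξ ≤ a ∧ M.savingValue c (a - ξ) ≤ M.marg ξ}

/-- Consumption functions of wealth on which the time iteration operator acts. -/
structure WealthPolicy (α κ : ℝ≥0) (c : ℝ≥0 → ℝ≥0) : Prop where
  mono : Monotone c
  le_add : ∀ a b, a ≤ b → c b ≤ c a + (b - a)
  le_self : ∀ a, c a ≤ a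
  mul_le : ∀ a, α * a ≤ c a
  marg_le : ∀ a, M.marg (c a) ≤ M.marg a + κ

variable {M} {α κ : ℝ≥0} {c d : ℝ≥0 → ℝ≥0}

lemma WealthPolicy.continuous (hc : M.WealthPolicy α κ c) : Continuous c := by
  have h : LipschitzWith 1 fun a => (c a : ℝ) := by
    refine LipschitzWith.of_le_add fun a b => ?_
    rcases le_total a b with h | h
    · exact (NNReal.coe_le_coe.2 (hc.mono h)).trans (le_add_of_nonneg_right dist_nonneg)
    · refine (NNReal.coe_le_coe.2 (hc.le_add b a h)).trans ?_
      rw [NNReal.dist_eq, ← NNReal.coe_sub h, NNReal.abs_eq, NNReal.coe_add]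
  exact NNReal.isEmbedding_coe.continuous_iff.2 h.continuous

lemma WealthPolicy.pos (hα : 0 < α) (hc : M.WealthPolicy α κ c) {a : ℝ≥0} (ha : 0 < a) :
    0 < c a :=
  (mul_pos hα ha).trans_le (hc.mul_le a)

lemma nextWealth_mono (w : Z × E × F) : Monotone fun s => M.nextWealth s w := by
  intro s t h
  simp only [nextWealth]
  gcongr

lemma inc_le_nextWealth (s : ℝ≥0) (w : Z × E × F) : M.inc w ≤ M.nextWealth s w := le_add_self

lemma measurable_nextWealth :
    Measurable fun p : ℝ≥0 × (Z × E × F) => M.nextWealth p.1 p.2 :=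
  ((M.measurable_ret.comp measurable_snd).mul measurable_fst).add
    (M.measurable_inc.comp measurable_snd)

lemma savingValue_anti (hu : M.UtilityAssumption) (h : c ≤ d) (s : ℝ≥0) :
    M.savingValue d s ≤ M.savingValue c s := by
  unfold savingValue
  gcongr
  exact hu.antitone_marg (h _)

lemma antitone_savingValue (hu : M.UtilityAssumption) (hc : Monotone c) :
    Antitone (M.savingValue c) := by
  intro s t h
  unfold savingValue
  gcongr
  exact hu.antitone_marg (hc (nextWealth_mono _ h))

/-- Next wealth is at least `Y`, so the bound is uniform in savings and in `c`. It is the source of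
every integrable majorant and of transversality. -/
lemma marg_next_le (hu : M.UtilityAssumption) (hc : M.WealthPolicy α κ c) (s : ℝ≥0)
    (w : Z × E × F) : M.marg (c (M.nextWealth s w)) ≤ M.marg (M.inc w) + κ :=
  (hc.marg_le _).trans (by gcongr; exact hu.antitone_marg (inc_le_nextWealth s w))

lemma measurable_ret_mul_marg (hu : M.UtilityAssumption) (hc : Measurable c) (s : ℝ≥0) :
    Measurable fun w => (M.ret w : ℝ≥0∞) * M.marg (c (M.nextWealth s w)) :=
  M.measurable_ret.coe_nnreal_ennreal.mul (hu.measurable_marg.comp (hc.comp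
    (measurable_nextWealth.comp (measurable_const.prodMk measurable_id))))

lemma lintegral_ret_mul_marg_add (κ : ℝ≥0) :
    ∫⁻ w, (M.ret w : ℝ≥0∞) * (M.marg (M.inc w) + κ) ∂M.shock
      = ∫⁻ w, (M.ret w : ℝ≥0∞) * M.marg (M.inc w) ∂M.shock + M.meanRet * κ := by
  simp only [mul_add]
  rw [lintegral_add_right _ (M.measurable_ret.coe_nnreal_ennreal.mul_const _),
    lintegral_mul_const _ M.measurable_ret.coe_nnreal_ennreal, meanRet]

lemma lintegral_ret_mul_marg_add_ne_top (hmom : M.MomentAssumption)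
    (κ : ℝ≥0) : ∫⁻ w, (M.ret w : ℝ≥0∞) * (M.marg (M.inc w) + κ) ∂M.shock ≠ ⊤ := by
  rw [lintegral_ret_mul_marg_add]
  exact ENNReal.add_ne_top.2 ⟨hmom.2.2.ne, ENNReal.mul_ne_top hmom.1.ne ENNReal.coe_ne_top⟩

lemma continuous_savingValue (hu : M.UtilityAssumption) (hmom : M.MomentAssumption)
    (hc : M.WealthPolicy α κ c) : Continuous (M.savingValue c) := by
  refine (ENNReal.continuous_const_mul ENNReal.coe_ne_top).comp ?_
  refine continuous_iff_seqContinuous.2 fun x s hx => ?_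
  refine tendsto_lintegral_of_dominated_convergence
    (fun w => (M.ret w : ℝ≥0∞) * (M.marg (M.inc w) + κ))
    (fun n => measurable_ret_mul_marg hu hc.continuous.measurable _)
    (fun n => ae_of_all _ fun w => ?_) (lintegral_ret_mul_marg_add_ne_top hmom κ)
    (ae_of_all _ fun w => ?_)
  · dsimp only
    gcongr
    exact marg_next_le hu hc _ w
  · have h : Continuous fun s => (M.ret w : ℝ≥0∞) * M.marg (c (M.nextWealth s w)) := by
      refine (ENNReal.continuous_const_mul ENNReal.coe_ne_top).comp
        (hu.continuous_marg.comp (hc.continuous.comp ?_))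
      unfold nextWealth
      fun_prop
    exact (h.tendsto s).comp hx

lemma savingValue_le (hu : M.UtilityAssumption) (hc : M.WealthPolicy α κ c) (s : ℝ≥0) :
    M.savingValue c s ≤ M.β * ∫⁻ w, (M.ret w : ℝ≥0∞) * M.marg (M.inc w) ∂M.shock
      + M.β * M.meanRet * κ := by
  rw [mul_assoc, ← mul_add, ← lintegral_ret_mul_marg_add]
  unfold savingValue
  gcongr with w
  exact marg_next_le hu hc _ w

lemma savingValue_ne_top (hu : M.UtilityAssumption) (hmom : M.MomentAssumption)
    (hc : M.WealthPolicy α κ c) (s : ℝ≥0) : M.savingValue c s ≠ ⊤ := by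
  refine ne_top_of_le_ne_top ?_ (savingValue_le hu hc s)
  exact ENNReal.add_ne_top.2 ⟨ENNReal.mul_ne_top ENNReal.coe_ne_top hmom.2.2.ne,
    ENNReal.mul_ne_top (ENNReal.mul_ne_top ENNReal.coe_ne_top hmom.1.ne) ENNReal.coe_ne_top⟩

lemma timeIter_le_self (c : ℝ≥0 → ℝ≥0) (a : ℝ≥0) : M.timeIter c a ≤ a :=
  csSup_le ⟨0, zero_le, by rw [marg_zero]; exact le_top⟩ fun _ h => h.1

lemma le_timeIter {ξ a : ℝ≥0} (h : ξ ≤ a) (h' : M.savingValue c (a - ξ) ≤ M.marg ξ) :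
    ξ ≤ M.timeIter c a :=
  le_csSup ⟨a, fun _ h => h.1⟩ ⟨h, h'⟩

/-- The set of admissible consumptions is closed, and contains 0 because `u'(0) = ∞`; its supremum
is attained. -/
lemma savingValue_timeIter_le (hu : M.UtilityAssumption) (hmom : M.MomentAssumption)
    (hc : M.WealthPolicy α κ c) (a : ℝ≥0) :
    M.savingValue c (a - M.timeIter c a) ≤ M.marg (M.timeIter c a) := by
  have hcl : IsClosed {ξ | ξ ≤ a ∧ M.savingValue c (a - ξ) ≤ M.marg ξ} :=
    (isClosed_le continuous_id continuous_const).inter (isClosed_le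
      ((continuous_savingValue hu hmom hc).comp (continuous_const.sub continuous_id))
      hu.continuous_marg)
  exact (hcl.csSup_mem ⟨0, zero_le, by rw [marg_zero]; exact le_top⟩ ⟨a, fun _ h => h.1⟩).2

/-- If not all wealth is consumed, the Euler inequality holds with equality. -/
lemma savingValue_timeIter_eq (hu : M.UtilityAssumption) (hmom : M.MomentAssumption)
    (hc : M.WealthPolicy α κ c) {a : ℝ≥0} (ha : M.timeIter c a < a) :
    M.savingValue c (a - M.timeIter c a) = M.marg (M.timeIter c a) := by
  refine (savingValue_timeIter_le hu hmom hc a).antisymm (not_lt.1 fun h => ?_)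
  -- A strict inequality would persist slightly to the right of the supremum.
  have hop : IsOpen {ξ | ξ < a ∧ M.savingValue c (a - ξ) < M.marg ξ} :=
    (isOpen_lt continuous_id continuous_const).inter (isOpen_lt
      ((continuous_savingValue hu hmom hc).comp (continuous_const.sub continuous_id))
      hu.continuous_marg)
  have hn : {ξ | ξ < a ∧ M.savingValue c (a - ξ) < M.marg ξ} ∈ 𝓝[>] (M.timeIter c a) :=
    nhdsWithin_le_nhds (hop.mem_nhds ⟨ha, h⟩)
  have : (𝓝[>] (M.timeIter c a)).NeBot := nhdsGT_neBot_of_exists_gt ⟨a, ha⟩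
  obtain ⟨ξ, hξ, hgt⟩ := (((eventually_of_mem hn) fun _ h => h).and
    (eventually_mem_nhdsWithin)).exists
  exact (le_timeIter hξ.1.le hξ.2.le).not_gt hgt

/-- A larger future consumption lowers the value of saving and so enlarges the admissible set. -/
lemma timeIter_mono_policy (hu : M.UtilityAssumption) (hmom : M.MomentAssumption)
    (hc : M.WealthPolicy α κ c) (h : c ≤ d) : M.timeIter c ≤ M.timeIter d := fun a =>
  le_timeIter (timeIter_le_self c a)
    ((savingValue_anti hu h _).trans (savingValue_timeIter_le hu hmom hc a))

lemma wealthPolicy_id (M : IncomeFluctuation Z E F) (κ : ℝ≥0) (hα : α < 1) :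
    M.WealthPolicy α κ id where
  mono := monotone_id
  le_add a b h := by simp only [id]; rw [add_tsub_cancel_of_le h]
  le_self _ := le_rfl
  mul_le a := mul_le_of_le_one_left (zero_le) hα.le
  marg_le _ := le_self_add

/-- The class of wealth policies is invariant under time iteration. -/
lemma wealthPolicy_timeIter (hu : M.UtilityAssumption) (hmom : M.MomentAssumption)
    (hα₁ : α < 1)
    (hsav : ∀ a : ℝ≥0, 0 < a →
      (M.β : ℝ≥0∞) * ∫⁻ w, (M.ret w : ℝ≥0∞) * M.marg (M.ret w * (1 - α) * a) ∂M.shock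
        ≤ M.marg a)
    (hκ : M.β * ∫⁻ w, (M.ret w : ℝ≥0∞) * M.marg (M.inc w) ∂M.shock
      + M.β * M.meanRet * κ ≤ κ)
    (hc : M.WealthPolicy α κ c) : M.WealthPolicy α κ (M.timeIter c) where
  mono a b h := le_timeIter ((timeIter_le_self c a).trans h)
    ((antitone_savingValue hu hc.mono (tsub_le_tsub_right h _)).trans
      (savingValue_timeIter_le hu hmom hc a))
  -- Lowering consumption at `b` by `b - a` leaves savings unchanged and raises marginal utility, so
  -- the result is admissible at `a`.
  le_add a b h := by
    rw [← tsub_le_iff_right]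
    rcases le_total (M.timeIter c b) (b - a) with h1 | h1
    · rw [tsub_eq_zero_of_le h1]; exact zero_le
    have hb := timeIter_le_self (M := M) c b
    have e : a - (M.timeIter c b - (b - a)) = b - M.timeIter c b := by
      rw [tsub_tsub_eq_add_tsub_of_le h1, add_tsub_cancel_of_le h]
    refine le_timeIter ?_ ?_
    · rw [tsub_le_iff_right, add_tsub_cancel_of_le h]; exact hb
    · rw [e]
      exact (savingValue_timeIter_le hu hmom hc b).trans (hu.antitone_marg tsub_le_self)
  le_self := timeIter_le_self c
  -- Test `ξ = α a`. Next wealth is at least `R (1 - α) a`, so next consumption is at least `R (1 -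
  -- α) (α a)`, and the saving assumption is applied at `α a`.
  mul_le a := by
    rcases eq_zero_or_pos α with rfl | hα
    · rw [zero_mul]; exact zero_le
    rcases eq_zero_or_pos a with rfl | ha
    · rw [mul_zero]; exact zero_le
    refine le_timeIter (mul_le_of_le_one_left (zero_le) hα₁.le) ?_
    refine le_trans ?_ (hsav (α * a) (mul_pos hα ha))
    unfold savingValue
    gcongr with w
    refine hu.antitone_marg (le_trans ?_ (hc.mul_le _))
    calc M.ret w * (1 - α) * (α * a) = α * (M.ret w * ((1 - α) * a)) := by ring
      _ = α * (M.ret w * (a - α * a)) := by rw [tsub_mul, one_mul]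
      _ ≤ α * M.nextWealth (a - α * a) w := by gcongr; exact le_self_add
  -- Either everything is consumed, or the Euler equation holds and the choice of `κ` bounds its
  -- left-hand side by `κ`.
  marg_le a := by
    rcases (timeIter_le_self (M := M) c a).eq_or_lt with h | h
    · rw [h]; exact le_self_add
    · rw [← savingValue_timeIter_eq hu hmom hc h]
      exact ((savingValue_le hu hc _).trans hκ).trans le_add_self

lemma exists_marg_bound (hmom : M.MomentAssumption) (hθ : M.β * M.meanRet < 1) :
    ∃ κ : ℝ≥0, M.β * ∫⁻ w, (M.ret w : ℝ≥0∞) * M.marg (M.inc w) ∂M.shock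
      + M.β * M.meanRet * κ ≤ κ :=
  exists_add_mul_le (ENNReal.mul_ne_top ENNReal.coe_ne_top hmom.2.2.ne) hθ

/-- Marginal utility never vanishes, so neither `c` nor `s` matters: the degenerate case, in which
`u'Inv` has no meaning, occurs for all savings at once. -/
lemma savingValue_eq_zero_iff (hu : M.UtilityAssumption) (hc : Measurable c) (s : ℝ≥0) :
    M.savingValue c s = 0 ↔ M.β = 0 ∨ ∀ᵐ w ∂M.shock, M.ret w = 0 := by
  rw [savingValue, mul_eq_zero, lintegral_eq_zero_iff (measurable_ret_mul_marg hu hc s)]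
  simp [Filter.EventuallyEq, (hu.marg_pos _).ne']

/-- Concavity in wealth. -/
def WealthConcave (c : ℝ≥0 → ℝ≥0) : Prop :=
  ConcaveOn ℝ (Ioi 0) fun a : ℝ => (c a.toNNReal : ℝ)

lemma WealthPolicy.candidate [TopologicalSpace Z] (hu : M.UtilityAssumption) (hα : 0 < α)
    (hc : M.WealthPolicy α κ c) : M.Candidate fun s => c s.1 where
  continuousOn := (hc.continuous.comp continuous_fst).continuousOn
  mono a b _ _ h := hc.mono h
  pos a _ ha := hc.pos hα ha
  le a _ := hc.le_self a
  bounded := by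
    refine ⟨κ, fun a _ ha => ?_⟩
    have hca := hc.pos hα ha
    have h := hc.marg_le a
    have h2 : M.u' a ≤ M.u' (c a) := (hu.u'_le_u'_iff ha hca).2 (hc.le_self a)
    rw [M.marg_of_pos ha, M.marg_of_pos hca, ← ENNReal.ofReal_coe_nnreal,
      ← ENNReal.ofReal_add (hu.deriv_pos a ha).le κ.coe_nonneg,
      ENNReal.ofReal_le_ofReal_iff (add_nonneg (hu.deriv_pos a ha).le κ.coe_nonneg)] at h
    rw [abs_of_nonneg (sub_nonneg.2 h2)]
    linarith

/-- Time iteration preserves concavity. -/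
lemma wealthConcave_timeIter [TopologicalSpace Z] (hu : M.UtilityAssumption)
    (hmom : M.MomentAssumption) (hconc : M.ConcavityAssumption) (hα : 0 < α)
    (hc : M.WealthPolicy α κ c) (hK : M.WealthPolicy α κ (M.timeIter c))
    (hcc : WealthConcave c) : WealthConcave (M.timeIter c) := by
  have hphi : ConcaveOn ℝ (Ici 0) fun s : ℝ => M.u'Inv (M.savingValue c s.toNNReal).toReal := by
    unfold savingValue nextWealth
    exact hconc (fun s => c s.1) (hc.candidate hu hα) fun _ => hcc
  refine ⟨convex_Ioi 0, fun a ha b hb p q hp hq hpq => ?_⟩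
  have ha : 0 < a := ha
  have hb : 0 < b := hb
  lift a to ℝ≥0 using ha.le
  lift b to ℝ≥0 using hb.le
  lift p to ℝ≥0 using hp
  lift q to ℝ≥0 using hq
  simp only [smul_eq_mul]
  have ha' : 0 < a := ha
  have hb' : 0 < b := hb
  have e : ((p : ℝ) * a + q * b).toNNReal = p * a + q * b := by
    rw [← Real.toNNReal_coe (r := p * a + q * b)]; push_cast; rfl
  rw [e, Real.toNNReal_coe, Real.toNNReal_coe]
  suffices h : p * M.timeIter c a + q * M.timeIter c b ≤ M.timeIter c (p * a + q * b) by
    exact_mod_cast h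
  have hle := timeIter_le_self (M := M) c
  have hle2 : p * M.timeIter c a + q * M.timeIter c b ≤ p * a + q * b := by
    gcongr <;> exact hle _
  refine le_timeIter hle2 ?_
  by_cases h0 : M.savingValue c 0 = 0
  · have := (savingValue_eq_zero_iff hu hc.continuous.measurable _).1 h0
    rw [(savingValue_eq_zero_iff hu hc.continuous.measurable _).2 this]
    exact zero_le
  have hpos : ∀ s, 0 < (M.savingValue c s).toReal := fun s =>
    ENNReal.toReal_pos (fun h => h0 ((savingValue_eq_zero_iff hu hc.continuous.measurable _).2
      ((savingValue_eq_zero_iff hu hc.continuous.measurable _).1 h)))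
      (savingValue_ne_top hu hmom hc s)
  -- Admissible pairs of savings and consumption form the hypograph of the function assumed concave,
  -- so they are stable under convex combinations.
  have hiff : ∀ s ξ : ℝ≥0, 0 < ξ →
      (M.savingValue c s ≤ M.marg ξ ↔ (ξ : ℝ) ≤ M.u'Inv (M.savingValue c s).toReal) := by
    intro s ξ hξ
    rw [← hu.u'_le_u'_iff (hu.u'Inv_pos (hpos s)) (NNReal.coe_pos.2 hξ), hu.u'_u'Inv (hpos s),
      M.marg_of_pos hξ, ENNReal.le_ofReal_iff_toReal_le (savingValue_ne_top hu hmom hc s)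
        (hu.deriv_pos ξ hξ).le]
  have hξa := hK.pos hα ha'
  have hξb := hK.pos hα hb'
  have hpos' : 0 < p * M.timeIter c a + q * M.timeIter c b := by
    have hpq' : p + q = 1 := by exact_mod_cast hpq
    rcases eq_zero_or_pos p with rfl | hp
    · rw [zero_add] at hpq'; simpa [hpq'] using hξb
    · exact add_pos_of_pos_of_nonneg (mul_pos hp hξa) (zero_le)
  rw [hiff _ _ hpos']
  have h1 := (hiff _ _ hξa).1 (savingValue_timeIter_le hu hmom hc a)
  have h2 := (hiff _ _ hξb).1 (savingValue_timeIter_le hu hmom hc b)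
  have h3 := hphi.2 (x := ((a - M.timeIter c a : ℝ≥0) : ℝ)) (NNReal.coe_nonneg _)
    (y := ((b - M.timeIter c b : ℝ≥0) : ℝ)) (NNReal.coe_nonneg _) p.coe_nonneg q.coe_nonneg hpq
  simp only [smul_eq_mul, Real.toNNReal_coe] at h3
  have e2 : ((p : ℝ) * (a - M.timeIter c a : ℝ≥0) + q * (b - M.timeIter c b : ℝ≥0)).toNNReal
      = p * a + q * b - (p * M.timeIter c a + q * M.timeIter c b) := by
    rw [← Real.toNNReal_coe (r := p * a + q * b - _), NNReal.coe_sub hle2, NNReal.coe_sub (hle a),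
      NNReal.coe_sub (hle b)]
    push_cast
    congr 1
    ring
  rw [e2] at h3
  push_cast
  refine le_trans ?_ h3
  gcongr

/-- Iterates of the time iteration operator started at the policy of consuming everything. -/
def policyIterate (M : IncomeFluctuation Z E F) (n : ℕ) : ℝ≥0 → ℝ≥0 := M.timeIter^[n] id

lemma policyIterate_succ (n : ℕ) :
    M.policyIterate (n + 1) = M.timeIter (M.policyIterate n) :=
  Function.iterate_succ_apply' _ _ _

/-- The limit of time iteration. -/
def limitPolicy (M : IncomeFluctuation Z E F) (a : ℝ≥0) : ℝ≥0 := ⨅ n, M.policyIterate n a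

lemma limitPolicy_le (n : ℕ) (a : ℝ≥0) : M.limitPolicy a ≤ M.policyIterate n a :=
  ciInf_le (OrderBot.bddBelow _) n

/-- The first iterate lies below the identity, and monotonicity of the operator propagates this. -/
lemma antitone_policyIterate (hu : M.UtilityAssumption) (hmom : M.MomentAssumption)
    (hpol : ∀ n, M.WealthPolicy α κ (M.policyIterate n)) : Antitone M.policyIterate := by
  refine antitone_nat_of_succ_le fun n => ?_
  induction n with
  | zero => rw [policyIterate_succ]; exact timeIter_le_self _
  | succ n ih =>
    have h := timeIter_mono_policy hu hmom (hpol (n + 1)) ih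
    rwa [← policyIterate_succ, ← policyIterate_succ] at h

lemma tendsto_policyIterate (hu : M.UtilityAssumption) (hmom : M.MomentAssumption)
    (hpol : ∀ n, M.WealthPolicy α κ (M.policyIterate n)) (a : ℝ≥0) :
    Tendsto (fun n => M.policyIterate n a) atTop (𝓝 (M.limitPolicy a)) :=
  tendsto_atTop_ciInf (fun _ _ h => antitone_policyIterate hu hmom hpol h a) (OrderBot.bddBelow _)

lemma wealthPolicy_limitPolicy (hu : M.UtilityAssumption) (hmom : M.MomentAssumption)
    (hpol : ∀ n, M.WealthPolicy α κ (M.policyIterate n)) :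
    M.WealthPolicy α κ M.limitPolicy := by
  have ht := tendsto_policyIterate hu hmom hpol
  exact
  { mono := fun a b h => le_of_tendsto_of_tendsto' (ht a) (ht b) fun n => (hpol n).mono h
    le_add := fun a b h => le_of_tendsto_of_tendsto' (ht b) ((ht a).add_const _)
      fun n => (hpol n).le_add a b h
    le_self := fun a => le_of_tendsto' (ht a) fun n => (hpol n).le_self a
    mul_le := fun a => ge_of_tendsto' (ht a) fun n => (hpol n).mul_le a
    marg_le := fun a => le_of_tendsto' ((hu.continuous_marg.tendsto _).comp (ht a))
      fun n => (hpol n).marg_le a }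

lemma wealthConcave_limitPolicy (hu : M.UtilityAssumption) (hmom : M.MomentAssumption)
    (hpol : ∀ n, M.WealthPolicy α κ (M.policyIterate n))
    (hconc : ∀ n, WealthConcave (M.policyIterate n)) : WealthConcave M.limitPolicy := by
  have ht : ∀ a : ℝ, Tendsto (fun n => (M.policyIterate n a.toNNReal : ℝ)) atTop
      (𝓝 (M.limitPolicy a.toNNReal : ℝ)) := fun a =>
    (NNReal.continuous_coe.tendsto _).comp (tendsto_policyIterate hu hmom hpol a.toNNReal)
  exact ⟨convex_Ioi 0, fun a ha b hb p q hp hq hpq =>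
    le_of_tendsto_of_tendsto' (((ht a).const_smul p).add ((ht b).const_smul q)) (ht _)
      fun n => (hconc n).2 ha hb hp hq hpq⟩

lemma tendsto_savingValue_policyIterate (hu : M.UtilityAssumption) (hmom : M.MomentAssumption)
    (hpol : ∀ n, M.WealthPolicy α κ (M.policyIterate n)) (s : ℝ≥0) :
    Tendsto (fun n => M.savingValue (M.policyIterate n) s) atTop
      (𝓝 (M.savingValue M.limitPolicy s)) := by
  refine ENNReal.Tendsto.const_mul ?_ (Or.inr ENNReal.coe_ne_top)
  refine tendsto_lintegral_of_dominated_convergence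
    (fun w => (M.ret w : ℝ≥0∞) * (M.marg (M.inc w) + κ))
    (fun n => measurable_ret_mul_marg hu (hpol n).continuous.measurable _)
    (fun n => ae_of_all _ fun w => ?_) (lintegral_ret_mul_marg_add_ne_top hmom κ)
    (ae_of_all _ fun w => ?_)
  · dsimp only
    gcongr
    exact marg_next_le hu (hpol n) _ w
  · exact ENNReal.Tendsto.const_mul ((hu.continuous_marg.tendsto _).comp
      (tendsto_policyIterate hu hmom hpol _)) (Or.inr ENNReal.coe_ne_top)

/-- One inequality follows from monotonicity, the limit being below every iterate. For the other,
the Euler inequality linking iterates `n` and `n + 1` passes to the limit, so the limit is itself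
admissible. -/
lemma timeIter_limitPolicy (hu : M.UtilityAssumption) (hmom : M.MomentAssumption)
    (hpol : ∀ n, M.WealthPolicy α κ (M.policyIterate n)) :
    M.timeIter M.limitPolicy = M.limitPolicy := by
  have hlim := wealthPolicy_limitPolicy hu hmom hpol
  refine le_antisymm (fun a => ?_) (fun a => ?_)
  · refine ge_of_tendsto' ((tendsto_policyIterate hu hmom hpol a).comp (tendsto_add_atTop_nat 1))
      fun n => ?_
    simp only [Function.comp_apply]
    rw [policyIterate_succ]
    exact timeIter_mono_policy hu hmom hlim (limitPolicy_le n) a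
  · refine le_timeIter (hlim.le_self a) ?_
    refine le_of_tendsto' (tendsto_savingValue_policyIterate hu hmom hpol _) fun n => ?_
    have h1 := limitPolicy_le (M := M) (n + 1) a
    have h2 := savingValue_timeIter_le hu hmom (hpol n) a
    rw [← policyIterate_succ] at h2
    exact ((antitone_savingValue hu (hpol n).mono (tsub_le_tsub_left h1 a)).trans h2).trans
      (hu.antitone_marg h1)

/-- A wealth policy satisfying the Euler equation. -/
structure EulerPolicy (M : IncomeFluctuation Z E F) (α κ : ℝ≥0) (c : ℝ≥0 → ℝ≥0) : Prop
    extends M.WealthPolicy α κ c where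
  euler_le : ∀ a, M.savingValue c (a - c a) ≤ M.marg (c a)
  euler_eq : ∀ a, c a < a → M.savingValue c (a - c a) = M.marg (c a)

theorem exists_eulerPolicy [TopologicalSpace Z] (hu : M.UtilityAssumption)
    (hmom : M.MomentAssumption) (hconc : M.ConcavityAssumption) (hθ : M.β * M.meanRet < 1)
    (hα : 0 < α) (hα₁ : α < 1)
    (hsav : ∀ a : ℝ≥0, 0 < a →
      (M.β : ℝ≥0∞) * ∫⁻ w, (M.ret w : ℝ≥0∞) * M.marg (M.ret w * (1 - α) * a) ∂M.shock
        ≤ M.marg a) :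
    ∃ (κ : ℝ≥0) (c : ℝ≥0 → ℝ≥0), M.EulerPolicy α κ c ∧ WealthConcave c := by
  obtain ⟨κ, hκ⟩ := exists_marg_bound hmom hθ
  have hpol : ∀ n, M.WealthPolicy α κ (M.policyIterate n) := by
    intro n
    induction n with
    | zero => exact wealthPolicy_id M κ hα₁
    | succ n ih =>
      rw [policyIterate_succ]
      exact wealthPolicy_timeIter hu hmom hα₁ hsav hκ ih
  have hcon : ∀ n, WealthConcave (M.policyIterate n) := by
    intro n
    induction n with
    | zero =>
      refine (concaveOn_id (convex_Ioi (0 : ℝ))).congr fun a ha => ?_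
      exact (Real.coe_toNNReal a (le_of_lt ha)).symm
    | succ n ih =>
      have h := hpol (n + 1)
      rw [policyIterate_succ] at h ⊢
      exact wealthConcave_timeIter hu hmom hconc hα (hpol n) h ih
  have hlim := wealthPolicy_limitPolicy hu hmom hpol
  have hfix := timeIter_limitPolicy hu hmom hpol
  refine ⟨κ, M.limitPolicy, ⟨hlim, fun a => ?_, fun a ha => ?_⟩,
    wealthConcave_limitPolicy hu hmom hpol hcon⟩
  · have := savingValue_timeIter_le hu hmom hlim a
    rwa [hfix] at this
  · have := savingValue_timeIter_eq hu hmom hlim (a := a) (by rwa [hfix])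
    rwa [hfix] at this

end Operator

/-! ### Optimality -/

section Verification

/-- Telescoping of one-period inequalities between nonnegative quantities. -/
lemma tsum_add_le_of_telescope {g k pc pd px pa : ℕ → ℝ≥0∞} {δ : ℝ≥0∞}
    (h : ∀ t, g t + pc t ≤ k t + pd t) (h₀ : g 0 + pc 0 + δ ≤ k 0 + pd 0)
    (hstep : ∀ t, pd t + px (t + 1) + pa t ≤ pc t + px t + pa (t + 1))
    (hpc : ∀ t, pc t ≠ ⊤) (hpd : ∀ t, pd t ≠ ⊤) (hpx : ∀ t, px t ≠ ⊤) (hpa : ∀ t, pa t ≠ ⊤)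
    (hinit : px 0 = pa 0) (hlim : Tendsto pa atTop (𝓝 0)) :
    ∑' t, g t + δ ≤ ∑' t, k t := by
  -- Differences are never formed in `ℝ≥0∞`: inequalities are added and finite terms cancelled. The
  -- slack is `δ` at time 0 and zero later.
  have hcomb : ∀ t (ε : ℝ≥0∞), g t + pc t + ε ≤ k t + pd t →
      g t + ε + px (t + 1) + pa t ≤ k t + px t + pa (t + 1) := by
    intro t ε hε
    refine (ENNReal.add_le_add_iff_right (ENNReal.add_ne_top.2 ⟨hpc t, hpd t⟩)).1 ?_
    calc g t + ε + px (t + 1) + pa t + (pc t + pd t)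
        = (g t + pc t + ε) + (pd t + px (t + 1) + pa t) := by ring
      _ ≤ (k t + pd t) + (pc t + px t + pa (t + 1)) := add_le_add hε (hstep t)
      _ = _ := by ring
  have hsum : ∀ T, ∑ t ∈ Finset.range (T + 1), g t + δ + px (T + 1) + pa 0
      ≤ ∑ t ∈ Finset.range (T + 1), k t + px 0 + pa (T + 1) := by
    intro T
    induction T with
    | zero => simpa using hcomb 0 δ h₀
    | succ T ih =>
      rw [Finset.sum_range_succ _ (T + 1), Finset.sum_range_succ _ (T + 1)]
      refine (ENNReal.add_le_add_iff_right
        (ENNReal.add_ne_top.2 ⟨hpx (T + 1), hpa (T + 1)⟩)).1 ?_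
      have h1 := hcomb (T + 1) 0 (by simpa using h (T + 1))
      rw [add_zero] at h1
      calc _ = (∑ t ∈ Finset.range (T + 1), g t + δ + px (T + 1) + pa 0)
            + (g (T + 1) + px (T + 1 + 1) + pa (T + 1)) := by ring
        _ ≤ _ := add_le_add ih h1
        _ = _ := by ring
  -- The terminal wealth of the competitor is dropped and the equal initial wealths cancel; only the
  -- vanishing term `pa (T + 1)` remains.
  have hbound : ∀ T, ∑ t ∈ Finset.range (T + 1), g t + δ ≤ ∑' t, k t + pa (T + 1) := by
    intro T
    refine (ENNReal.add_le_add_iff_right (hpa 0)).1 ?_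
    calc ∑ t ∈ Finset.range (T + 1), g t + δ + pa 0
        ≤ ∑ t ∈ Finset.range (T + 1), g t + δ + px (T + 1) + pa 0 := by
          exact add_le_add_left le_self_add _
      _ ≤ _ := hsum T
      _ ≤ ∑' t, k t + px 0 + pa (T + 1) := by gcongr; exact ENNReal.sum_le_tsum _
      _ = _ := by rw [hinit]; ring
  have ht1 : Tendsto (fun T => ∑ t ∈ Finset.range (T + 1), g t + δ) atTop (𝓝 (∑' t, g t + δ)) :=
    ((ENNReal.tendsto_nat_tsum g).comp (tendsto_add_atTop_nat 1)).add tendsto_const_nhds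
  have ht2 : Tendsto (fun T => ∑' t, k t + pa (T + 1)) atTop (𝓝 (∑' t, k t + 0)) :=
    tendsto_const_nhds.add (hlim.comp (tendsto_add_atTop_nat 1))
  simpa using le_of_tendsto_of_tendsto' ht1 ht2 hbound

/-- `N` may be infinite: a feasible competitor is allowed the value `-∞`. -/
lemma coe_sub_coe_le_of_add_le {P N P' N' δ : ℝ≥0∞} (hP : P ≠ ⊤) (hP' : P' ≠ ⊤) (hN' : N' ≠ ⊤)
    (h : P + N' + δ ≤ P' + N) :
    (P : EReal) - N ≤ (P' : EReal) - N' ∧ (0 < δ → (P : EReal) - N < (P' : EReal) - N') := by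
  lift P to ℝ≥0 using hP
  lift P' to ℝ≥0 using hP'
  lift N' to ℝ≥0 using hN'
  have hc : ∀ x : ℝ≥0, (((x : ℝ≥0∞)) : EReal) = ((x : ℝ) : EReal) := fun x => rfl
  rcases eq_or_ne N ⊤ with rfl | hN
  · have h1 : ((P : ℝ≥0∞) : EReal) - ((⊤ : ℝ≥0∞) : EReal) = ⊥ := by
      rw [EReal.coe_ennreal_top, hc]; rfl
    rw [h1]
    refine ⟨bot_le, fun _ => ?_⟩
    rw [hc, hc, ← EReal.coe_sub]
    exact EReal.bot_lt_coe _
  · lift N to ℝ≥0 using hN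
    have hδ : δ ≠ ⊤ := ne_top_of_le_ne_top (b := (P' : ℝ≥0∞) + N) (by finiteness)
      (le_add_self.trans h)
    lift δ to ℝ≥0 using hδ
    have h' : (P : ℝ) + N' + δ ≤ P' + N := by exact_mod_cast h
    rw [hc, hc, hc, hc, ← EReal.coe_sub, ← EReal.coe_sub, EReal.coe_le_coe_iff,
      EReal.coe_lt_coe_iff]
    refine ⟨by linarith [δ.coe_nonneg], fun h0 => ?_⟩
    have : (0 : ℝ) < δ := by exact_mod_cast h0
    linarith

variable {M : IncomeFluctuation Z E F} {α κ : ℝ≥0} {c : ℝ≥0 → ℝ≥0} {d : ℝ≥0 × Z → ℝ≥0}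

lemma tsum_discount_pow_ne_top (M : IncomeFluctuation Z E F) :
    ∑' t, (M.β : ℝ≥0∞) ^ t ≠ ⊤ := by
  rw [ENNReal.tsum_geometric]
  exact ENNReal.inv_ne_top.2 (tsub_pos_of_lt (by exact_mod_cast M.β_lt_one)).ne'

lemma tsum_discount_ne_top {f g : ℕ → ℝ≥0∞} {A B : ℝ≥0∞} (hA : A ≠ ⊤) (hB : B ≠ ⊤)
    (hg : ∑' t, (M.β : ℝ≥0∞) ^ t * g t ≠ ⊤) (h : ∀ t, f t ≤ A * g t + B) :
    ∑' t, (M.β : ℝ≥0∞) ^ t * f t ≠ ⊤ := by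
  refine ne_top_of_le_ne_top (ENNReal.add_ne_top.2
    ⟨ENNReal.mul_ne_top hA hg, ENNReal.mul_ne_top hB M.tsum_discount_pow_ne_top⟩) ?_
  rw [← ENNReal.tsum_mul_left, ← ENNReal.tsum_mul_left, ← ENNReal.tsum_add]
  refine ENNReal.tsum_le_tsum fun t => ?_
  calc (M.β : ℝ≥0∞) ^ t * f t ≤ (M.β : ℝ≥0∞) ^ t * (A * g t + B) := by gcongr; exact h t
    _ = _ := by ring

lemma tsum_discount_ne_top_of_succ {f g : ℕ → ℝ≥0∞} {A B : ℝ≥0∞} (hA : A ≠ ⊤) (hB : B ≠ ⊤)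
    (hg : ∑' t, (M.β : ℝ≥0∞) ^ t * g t ≠ ⊤) (h₀ : f 0 ≠ ⊤) (h : ∀ t, f (t + 1) ≤ A * g t + B) :
    ∑' t, (M.β : ℝ≥0∞) ^ t * f t ≠ ⊤ := by
  rw [tsum_eq_zero_add' ENNReal.summable]
  refine ENNReal.add_ne_top.2 ⟨by simpa using h₀, ?_⟩
  simp only [pow_succ', mul_assoc]
  rw [ENNReal.tsum_mul_left]
  exact ENNReal.mul_ne_top ENNReal.coe_ne_top (tsum_discount_ne_top hA hB hg h)

lemma measurable_statePath (hd : Measurable d) (a : ℝ≥0) (z : Z) (t : ℕ) :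
    Measurable fun ω => M.statePath d a z ω t := by
  induction t with
  | zero => exact measurable_const
  | succ t ih =>
    refine Measurable.prodMk ?_ (measurable_fst.comp (measurable_pi_apply t))
    exact measurable_nextWealth.comp
      ((ih.fst.sub (hd.comp ih)).prodMk (measurable_pi_apply t))

lemma statePath_congr (d : ℝ≥0 × Z → ℝ≥0) (a : ℝ≥0) (z : Z) (t : ℕ)
    {ω ω' : ℕ → Z × E × F} (h : ∀ i < t, ω i = ω' i) :
    M.statePath d a z ω t = M.statePath d a z ω' t := by
  induction t with
  | zero => rfl
  | succ t ih =>
    rw [statePath, statePath, ih fun i hi => h i (hi.trans (Nat.lt_succ_self t)),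
      h t (Nat.lt_succ_self t)]

/-- Expected wealth at time `t`. -/
def meanWealth (M : IncomeFluctuation Z E F) (d : ℝ≥0 × Z → ℝ≥0) (a : ℝ≥0) (z : Z) (t : ℕ) :
    ℝ≥0∞ :=
  ∫⁻ ω, ((M.statePath d a z ω t).1 : ℝ≥0∞) ∂M.pathLaw

/-- A bound for the expectation of next period's wealth, weighted by a function of next period's
shock. -/
lemma lintegral_weight_nextWealth_le {h : Z × E × F → ℝ≥0∞} (hh : Measurable h)
    (hd : Measurable d) (a : ℝ≥0) (z : Z) (t : ℕ) :
    ∫⁻ ω, h (ω t) * ((M.statePath d a z ω (t + 1)).1 : ℝ≥0∞) ∂M.pathLaw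
      ≤ (∫⁻ w, h w * M.ret w ∂M.shock) * M.meanWealth d a z t + ∫⁻ w, h w * M.inc w ∂M.shock := by
  have hm := measurable_statePath (M := M) hd a z t
  have hR := M.measurable_ret.coe_nnreal_ennreal
  have hY := M.measurable_inc.coe_nnreal_ennreal
  calc ∫⁻ ω, h (ω t) * ((M.statePath d a z ω (t + 1)).1 : ℝ≥0∞) ∂M.pathLaw
      ≤ ∫⁻ ω, h (ω t) * ((M.ret (ω t) : ℝ≥0∞) * (M.statePath d a z ω t).1 + M.inc (ω t))
          ∂M.pathLaw := by
        gcongr with ω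
        norm_cast
        simp only [statePath, nextWealth]
        gcongr
        exact tsub_le_self
    _ = ∫⁻ ω, ∫⁻ w, h w * ((M.ret w : ℝ≥0∞) * (M.statePath d a z ω t).1 + M.inc w)
          ∂M.shock ∂M.pathLaw := by
        refine M.lintegral_pathLaw_eq (f := fun ω => M.statePath d a z ω t) hm
          (fun ω ω' h => statePath_congr d a z t h)
          (G := fun s w => h w * ((M.ret w : ℝ≥0∞) * s.1 + M.inc w)) ?_
        exact (hh.comp measurable_snd).mul (((hR.comp measurable_snd).mul
          (measurable_fst.comp measurable_fst).coe_nnreal_ennreal).add (hY.comp measurable_snd))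
    _ = ∫⁻ ω, ((∫⁻ w, h w * M.ret w ∂M.shock) * (M.statePath d a z ω t).1
          + ∫⁻ w, h w * M.inc w ∂M.shock) ∂M.pathLaw := by
        have hhR : Measurable fun w => h w * (M.ret w : ℝ≥0∞) := hh.mul hR
        have hhY : Measurable fun w => h w * (M.inc w : ℝ≥0∞) := hh.mul hY
        refine lintegral_congr fun ω => ?_
        rw [← lintegral_mul_const _ hhR, ← lintegral_add_right _ hhY]
        refine lintegral_congr fun w => ?_
        ring
    _ = _ := by
        rw [lintegral_add_right _ measurable_const, lintegral_const_mul _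
          hm.fst.coe_nnreal_ennreal, lintegral_const, measure_univ, mul_one, meanWealth]

/-- Discounted expected wealth is summable along every feasible policy. -/
lemma tsum_meanWealth_ne_top (hd : Measurable d) (hθ : M.β * M.meanRet < 1)
    (hY : M.meanInc ≠ ⊤) (a : ℝ≥0) (z : Z) :
    ∑' t, (M.β : ℝ≥0∞) ^ t * M.meanWealth d a z t ≠ ⊤ := by
  have hsucc : ∀ t, M.meanWealth d a z (t + 1) ≤ M.meanRet * M.meanWealth d a z t + M.meanInc := by
    intro t
    have := lintegral_weight_nextWealth_le (M := M) (h := fun _ => 1) measurable_const hd a z t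
    simp only [one_mul] at this
    exact this
  have h0 : M.meanWealth d a z 0 = a := by simp [meanWealth, statePath]
  -- The partial sums satisfy `S_{T+1} ≤ A + β 𝔼 R · S_T` with this constant `A`, so a bound `C`
  -- with `A + β 𝔼 R · C ≤ C` is inherited from `T` to `T + 1`.
  obtain ⟨C, hC⟩ := exists_add_mul_le (A := a + M.β * M.meanInc * ∑' t, (M.β : ℝ≥0∞) ^ t)
    (ENNReal.add_ne_top.2 ⟨ENNReal.coe_ne_top, ENNReal.mul_ne_top
      (ENNReal.mul_ne_top ENNReal.coe_ne_top hY) M.tsum_discount_pow_ne_top⟩) hθ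
  refine ne_top_of_le_ne_top (ENNReal.coe_ne_top (r := C)) ?_
  refine ENNReal.tsum_le_of_sum_range_le fun T => ?_
  induction T with
  | zero => simp
  | succ T ih =>
    refine le_trans ?_ hC
    rw [Finset.sum_range_succ', pow_zero, one_mul, h0, add_comm, add_assoc]
    gcongr
    calc ∑ t ∈ Finset.range T, (M.β : ℝ≥0∞) ^ (t + 1) * M.meanWealth d a z (t + 1)
        ≤ ∑ t ∈ Finset.range T, (M.β * M.meanInc * (M.β : ℝ≥0∞) ^ t
          + M.β * M.meanRet * ((M.β : ℝ≥0∞) ^ t * M.meanWealth d a z t)) := by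
          refine Finset.sum_le_sum fun t _ => ?_
          calc _ ≤ (M.β : ℝ≥0∞) ^ (t + 1) * (M.meanRet * M.meanWealth d a z t + M.meanInc) := by
                gcongr; exact hsucc t
            _ = _ := by ring
      _ = M.β * M.meanInc * ∑ t ∈ Finset.range T, (M.β : ℝ≥0∞) ^ t
          + M.β * M.meanRet * ∑ t ∈ Finset.range T, (M.β : ℝ≥0∞) ^ t * M.meanWealth d a z t := by
          rw [Finset.sum_add_distrib, Finset.mul_sum, Finset.mul_sum]
      _ ≤ _ := by
          gcongr
          exact ENNReal.sum_le_tsum _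

/-- The value at time `t` of the wealth process of `d`, at the shadow prices of the policy `c`. -/
def pricedWealth (M : IncomeFluctuation Z E F) (c : ℝ≥0 → ℝ≥0) (d : ℝ≥0 × Z → ℝ≥0) (a : ℝ≥0)
    (z : Z) (t : ℕ) : ℝ≥0∞ :=
  ∫⁻ ω, M.marg (c (M.statePath (fun s => c s.1) a z ω t).1) * (M.statePath d a z ω t).1 ∂M.pathLaw

/-- The value at time `t` of the consumption process of `d`, at the shadow prices of the
policy `c`. -/
def pricedConsumption (M : IncomeFluctuation Z E F) (c : ℝ≥0 → ℝ≥0) (d : ℝ≥0 × Z → ℝ≥0) (a : ℝ≥0)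
    (z : Z) (t : ℕ) : ℝ≥0∞ :=
  ∫⁻ ω, M.marg (c (M.statePath (fun s => c s.1) a z ω t).1) * d (M.statePath d a z ω t) ∂M.pathLaw

lemma pricedConsumption_le (hd : Feasible d) (a : ℝ≥0) (z : Z) (t : ℕ) :
    M.pricedConsumption c d a z t ≤ M.pricedWealth c d a z t := by
  unfold pricedConsumption pricedWealth
  gcongr with ω
  exact hd.le _ _

/-- Transversality. -/
lemma tsum_pricedWealth_ne_top (hu : M.UtilityAssumption) (hmom : M.MomentAssumption)
    (hθ : M.β * M.meanRet < 1) (hY : M.meanInc ≠ ⊤) (hα : 0 < α) (hc : M.WealthPolicy α κ c)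
    (hd : Measurable d) {a : ℝ≥0} (ha : 0 < a) (z : Z) :
    ∑' t, (M.β : ℝ≥0∞) ^ t * M.pricedWealth c d a z t ≠ ⊤ := by
  have hmeas : Measurable fun w => M.marg (M.inc w) + (κ : ℝ≥0∞) :=
    (hu.measurable_marg.comp M.measurable_inc).add_const _
  -- From time 1 on, the price is at most `u'(Y) + κ` for the latest income, which is independent of
  -- earlier wealth; summability is inherited from expected wealth.
  refine tsum_discount_ne_top_of_succ (g := M.meanWealth d a z)
    (A := ∫⁻ w, (M.marg (M.inc w) + κ) * M.ret w ∂M.shock)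
    (B := ∫⁻ w, (M.marg (M.inc w) + κ) * M.inc w ∂M.shock) ?_ ?_
    (tsum_meanWealth_ne_top hd hθ hY a z) ?_ fun t => ?_
  · simpa only [mul_comm] using lintegral_ret_mul_marg_add_ne_top hmom κ
  · have hle : ∫⁻ w, (M.marg (M.inc w) + κ) * M.inc w ∂M.shock
        ≤ ∫⁻ w, (M.marg (M.inc w) + (M.marg 1 + κ) * M.inc w) ∂M.shock := by
      gcongr with w
      rw [add_mul, add_mul, ← add_assoc]
      gcongr
      exact hu.marg_mul_self_le _
    refine ne_top_of_le_ne_top ?_ hle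
    have hmi : Measurable fun w => M.marg (M.inc w) := hu.measurable_marg.comp M.measurable_inc
    rw [lintegral_add_left hmi, lintegral_const_mul _ M.measurable_inc.coe_nnreal_ennreal]
    exact ENNReal.add_ne_top.2 ⟨hmom.2.1.ne, ENNReal.mul_ne_top
      (ENNReal.add_ne_top.2 ⟨hu.marg_ne_top one_pos, ENNReal.coe_ne_top⟩) hY⟩
  · simpa [pricedWealth, statePath] using
      ENNReal.mul_ne_top (hu.marg_ne_top (hc.pos hα ha)) (ENNReal.coe_ne_top (r := a))
  · refine le_trans ?_ (lintegral_weight_nextWealth_le hmeas hd a z t)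
    unfold pricedWealth
    gcongr with ω
    exact marg_next_le hu hc _ (ω t)

lemma tsum_marg_ne_top (hu : M.UtilityAssumption) (hmom : M.MomentAssumption)
    (hα : 0 < α) (hc : M.WealthPolicy α κ c) {a : ℝ≥0} (ha : 0 < a) (z : Z) :
    ∑' t, (M.β : ℝ≥0∞) ^ t *
      ∫⁻ ω, M.marg (c (M.statePath (fun s => c s.1) a z ω t).1) ∂M.pathLaw ≠ ⊤ := by
  have hmeas : Measurable fun w => M.marg (M.inc w) + (κ : ℝ≥0∞) :=
    (hu.measurable_marg.comp M.measurable_inc).add_const _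
  refine tsum_discount_ne_top_of_succ (g := 0) (A := 0)
    (B := ∫⁻ w, (M.marg (M.inc w) + κ) ∂M.shock) ENNReal.zero_ne_top ?_ (by simp) ?_ fun t => ?_
  · rw [lintegral_add_right _ measurable_const]
    simpa using hmom.2.1.ne
  · simpa [statePath] using hu.marg_ne_top (hc.pos hα ha)
  · rw [zero_mul, zero_add, ← M.lintegral_pathLaw_eval hmeas t]
    gcongr with ω
    exact marg_next_le hu hc _ (ω t)

/-- The expected discounted priced wealth of next period, as a function of the savings `s` of the
pricing policy and the savings `y` of the priced policy. -/
lemma lintegral_priced_nextWealth (hu : M.UtilityAssumption) (hc : Measurable c)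
    {s y : (ℕ → Z × E × F) → ℝ≥0} (hs : Measurable s) (hy : Measurable y) {t : ℕ}
    (hs' : ∀ ω ω', (∀ i < t, ω i = ω' i) → s ω = s ω')
    (hy' : ∀ ω ω', (∀ i < t, ω i = ω' i) → y ω = y ω') :
    M.β * ∫⁻ ω, M.marg (c (M.nextWealth (s ω) (ω t))) * M.nextWealth (y ω) (ω t) ∂M.pathLaw
      = ∫⁻ ω, (M.savingValue c (s ω) * y ω
        + M.β * ∫⁻ w, M.marg (c (M.nextWealth (s ω) w)) * M.inc w ∂M.shock) ∂M.pathLaw := by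
  have hR := M.measurable_ret.coe_nnreal_ennreal
  have hI := M.measurable_inc.coe_nnreal_ennreal
  have hmarg : Measurable fun p : ℝ≥0 × (Z × E × F) => M.marg (c (M.nextWealth p.1 p.2)) :=
    hu.measurable_marg.comp (hc.comp measurable_nextWealth)
  have h := M.lintegral_pathLaw_eq (f := fun ω => (s ω, y ω)) (t := t) (hs.prodMk hy)
    (fun ω ω' h => by rw [hs' ω ω' h, hy' ω ω' h])
    (G := fun p w => M.marg (c (M.nextWealth p.1 w)) * M.nextWealth p.2 w)
    ((hmarg.comp ((measurable_fst.comp measurable_fst).prodMk measurable_snd)).mul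
      (measurable_nextWealth.comp
        ((measurable_snd.comp measurable_fst).prodMk measurable_snd)).coe_nnreal_ennreal)
  rw [h, ← lintegral_const_mul' _ _ ENNReal.coe_ne_top]
  refine lintegral_congr fun ω => ?_
  have hm : Measurable fun w => M.marg (c (M.nextWealth (s ω) w)) :=
    hmarg.comp (measurable_const.prodMk measurable_id)
  have hRm : Measurable fun w => (M.ret w : ℝ≥0∞) * M.marg (c (M.nextWealth (s ω) w)) := hR.mul hm
  have hmI : Measurable fun w => M.marg (c (M.nextWealth (s ω) w)) * (M.inc w : ℝ≥0∞) := hm.mul hI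
  rw [savingValue, mul_assoc, ← mul_add, ← lintegral_mul_const _ hRm,
    ← lintegral_add_right _ hmI]
  congr 1
  refine lintegral_congr fun w => ?_
  simp only [nextWealth]
  push_cast
  ring

/-- The one-period inequality for priced wealth that follows from the Euler equation. -/
lemma priced_step (hu : M.UtilityAssumption)
    (hc : M.EulerPolicy α κ c) (hd : Feasible d) (a : ℝ≥0) (z : Z) (t : ℕ) :
    M.pricedConsumption c d a z t + M.β * M.pricedWealth c d a z (t + 1)
        + M.pricedWealth c (fun s => c s.1) a z t
      ≤ M.pricedConsumption c (fun s => c s.1) a z t + M.pricedWealth c d a z t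
        + M.β * M.pricedWealth c (fun s => c s.1) a z (t + 1) := by
  have hcm : Measurable c := hc.toWealthPolicy.continuous.measurable
  have hcm' : Measurable fun s : ℝ≥0 × Z => c s.1 := hcm.comp measurable_fst
  have hA := measurable_statePath (M := M) hcm' a z t
  have hX := measurable_statePath (M := M) hd.measurable a z t
  set A := fun ω => M.statePath (fun s => c s.1) a z ω t with hAdef
  set X := fun ω => M.statePath d a z ω t with hXdef
  have hs : Measurable fun ω => (A ω).1 - c (A ω).1 := hA.fst.sub (hcm.comp hA.fst)
  have hy : Measurable fun ω => (X ω).1 - d (X ω) := hX.fst.sub (hd.measurable.comp hX)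
  have hs' : ∀ ω ω', (∀ i < t, ω i = ω' i) → (A ω).1 - c (A ω).1 = (A ω').1 - c (A ω').1 := by
    intro ω ω' h
    simp only [hAdef, statePath_congr _ a z t h]
  have hy' : ∀ ω ω', (∀ i < t, ω i = ω' i) → (X ω).1 - d (X ω) = (X ω').1 - d (X ω') := by
    intro ω ω' h
    simp only [hXdef, statePath_congr _ a z t h]
  have e1 : M.β * M.pricedWealth c d a z (t + 1) = _ :=
    lintegral_priced_nextWealth hu hcm hs hy hs' hy'
  have e2 : M.β * M.pricedWealth c (fun s => c s.1) a z (t + 1) = _ :=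
    lintegral_priced_nextWealth hu hcm hs hs hs' hs'
  have hp : Measurable fun ω => M.marg (c (A ω).1) := hu.measurable_marg.comp (hcm.comp hA.fst)
  have hpA : Measurable fun ω => M.marg (c (A ω).1) * ((A ω).1 : ℝ≥0∞) :=
    hp.mul hA.fst.coe_nnreal_ennreal
  have hpX : Measurable fun ω => M.marg (c (A ω).1) * ((X ω).1 : ℝ≥0∞) :=
    hp.mul hX.fst.coe_nnreal_ennreal
  have hpc : Measurable fun ω => M.marg (c (A ω).1) * (c (A ω).1 : ℝ≥0∞) :=
    hp.mul (hcm.comp hA.fst).coe_nnreal_ennreal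
  have hpd : Measurable fun ω => M.marg (c (A ω).1) * (d (X ω) : ℝ≥0∞) :=
    hp.mul (hd.measurable.comp hX).coe_nnreal_ennreal
  have hpcX : Measurable fun ω => M.marg (c (A ω).1) * (c (A ω).1 : ℝ≥0∞)
      + M.marg (c (A ω).1) * ((X ω).1 : ℝ≥0∞) := hpc.add hpX
  have e3 : M.pricedConsumption c d a z t
      = ∫⁻ ω, M.marg (c (A ω).1) * (d (X ω) : ℝ≥0∞) ∂M.pathLaw := rfl
  have e4 : M.pricedConsumption c (fun s => c s.1) a z t
      = ∫⁻ ω, M.marg (c (A ω).1) * (c (A ω).1 : ℝ≥0∞) ∂M.pathLaw := rfl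
  have e5 : M.pricedWealth c d a z t
      = ∫⁻ ω, M.marg (c (A ω).1) * ((X ω).1 : ℝ≥0∞) ∂M.pathLaw := rfl
  have e6 : M.pricedWealth c (fun s => c s.1) a z t
      = ∫⁻ ω, M.marg (c (A ω).1) * ((A ω).1 : ℝ≥0∞) ∂M.pathLaw := rfl
  rw [e1, e2, e3, e4, e5, e6, ← lintegral_add_left hpd, ← lintegral_add_right _ hpA,
    ← lintegral_add_left hpc, ← lintegral_add_left hpcX]
  refine lintegral_mono fun ω => ?_
  have hda : d (X ω) ≤ (X ω).1 := hd.le _ _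
  have hle := hc.euler_le (A ω).1
  have heq := hc.euler_eq (A ω).1
  have hAs : ((A ω).1 : ℝ≥0∞) = c (A ω).1 + ((A ω).1 - c (A ω).1 : ℝ≥0) := by
    rw [← ENNReal.coe_add, add_tsub_cancel_of_le (hc.le_self _)]
  have hXs : ((X ω).1 : ℝ≥0∞) = d (X ω) + ((X ω).1 - d (X ω) : ℝ≥0) := by
    rw [← ENNReal.coe_add, add_tsub_cancel_of_le hda]
  rw [← tsub_pos_iff_lt] at heq
  dsimp only
  rw [hXs, hAs]
  generalize (A ω).1 - c (A ω).1 = s at *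
  generalize (X ω).1 - d (X ω) = y at *
  generalize M.marg (c (A ω).1) = p at *
  generalize (M.β : ℝ≥0∞) * ∫⁻ w, M.marg (c (M.nextWealth s w)) * M.inc w ∂M.shock = r at *
  generalize M.savingValue c s = q at *
  -- Complementary slackness, `(q - p)(y - s) ≤ 0`: the Euler inequality gives `q ≤ p`, with
  -- equality unless `s = 0`, where `y ≥ s` is automatic.
  have hkey : q * y + p * s ≤ p * y + q * s := by
    rcases eq_zero_or_pos s with rfl | h
    · simpa using mul_le_mul_left hle (y : ℝ≥0∞)
    · rw [heq h]
  calc _ = p * d (X ω) + p * c (A ω).1 + r + (q * y + p * s) := by ring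
    _ ≤ p * d (X ω) + p * c (A ω).1 + r + (p * y + q * s) := by gcongr
    _ = _ := by ring

/-! ### Lifetime values and the verification theorem -/

lemma measurable_toENNReal_u (hu : M.UtilityAssumption) (hd : Measurable d) (a : ℝ≥0) (z : Z)
    (t : ℕ) : Measurable fun ω => (M.u (d (M.statePath d a z ω t))).toENNReal :=
  measurable_ereal_toENNReal.comp
    (hu.measurable_u.comp (hd.comp (measurable_statePath hd a z t)))

lemma measurable_toENNReal_neg_u (hu : M.UtilityAssumption) (hd : Measurable d) (a : ℝ≥0) (z : Z)
    (t : ℕ) : Measurable fun ω => (-M.u (d (M.statePath d a z ω t))).toENNReal :=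
  measurable_ereal_toENNReal.comp (continuous_neg.measurable.comp
    (hu.measurable_u.comp (hd.comp (measurable_statePath hd a z t))))

/-- Expected positive part of utility at time `t`. -/
def posUtility (M : IncomeFluctuation Z E F) (d : ℝ≥0 × Z → ℝ≥0) (a : ℝ≥0) (z : Z) (t : ℕ) :
    ℝ≥0∞ :=
  ∫⁻ ω, (M.u (d (M.statePath d a z ω t))).toENNReal ∂M.pathLaw

/-- Expected negative part of utility at time `t`. -/
def negUtility (M : IncomeFluctuation Z E F) (d : ℝ≥0 × Z → ℝ≥0) (a : ℝ≥0) (z : Z) (t : ℕ) :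
    ℝ≥0∞ :=
  ∫⁻ ω, (-M.u (d (M.statePath d a z ω t))).toENNReal ∂M.pathLaw

lemma lifetimeValue_eq (hu : M.UtilityAssumption) (hd : Measurable d) (a : ℝ≥0) (z : Z) :
    M.lifetimeValue d a z = ((∑' t, (M.β : ℝ≥0∞) ^ t * M.posUtility d a z t : ℝ≥0∞) : EReal)
      - ((∑' t, (M.β : ℝ≥0∞) ^ t * M.negUtility d a z t : ℝ≥0∞) : EReal) := by
  unfold lifetimeValue
  rw [lintegral_tsum fun t => ((measurable_toENNReal_u hu hd a z t).const_mul _).aemeasurable,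
    lintegral_tsum fun t => ((measurable_toENNReal_neg_u hu hd a z t).const_mul _).aemeasurable]
  simp only [lintegral_const_mul _ (measurable_toENNReal_u hu hd a z _),
    lintegral_const_mul _ (measurable_toENNReal_neg_u hu hd a z _), posUtility, negUtility]

lemma tsum_posUtility_ne_top (hu : M.UtilityAssumption) (hθ : M.β * M.meanRet < 1)
    (hY : M.meanInc ≠ ⊤) (hd : Feasible d) (a : ℝ≥0) (z : Z) :
    ∑' t, (M.β : ℝ≥0∞) ^ t * M.posUtility d a z t ≠ ⊤ := by
  refine tsum_discount_ne_top (A := M.marg 1) (B := (M.u 1).toENNReal) (hu.marg_ne_top one_pos)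
    (by simpa using hu.ne_top 1) (tsum_meanWealth_ne_top hd.measurable hθ hY a z) fun t => ?_
  have hm := (measurable_statePath (M := M) hd.measurable a z t).fst.coe_nnreal_ennreal
  calc M.posUtility d a z t
      ≤ ∫⁻ ω, (M.marg 1 * (M.statePath d a z ω t).1 + (M.u 1).toENNReal) ∂M.pathLaw := by
        unfold posUtility
        gcongr with ω
        refine (hu.toENNReal_u_le _).trans ?_
        rw [add_comm]
        gcongr
        exact hd.le _ _
    _ = _ := by
        rw [lintegral_add_right _ measurable_const, lintegral_const_mul _ hm, lintegral_const,
          measure_univ, mul_one, meanWealth]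

lemma tsum_negUtility_ne_top (hu : M.UtilityAssumption) (hmom : M.MomentAssumption)
    (hα : 0 < α) (hc : M.WealthPolicy α κ c) {a : ℝ≥0} (ha : 0 < a) (z : Z) :
    ∑' t, (M.β : ℝ≥0∞) ^ t * M.negUtility (fun s => c s.1) a z t ≠ ⊤ := by
  have hb : (-M.u 1).toENNReal ≠ ⊤ := by simpa using hu.ne_bot 1 one_pos
  refine tsum_discount_ne_top (A := 1) ENNReal.one_ne_top hb
    (tsum_marg_ne_top hu hmom hα hc ha z) fun t => ?_
  rw [one_mul]
  calc M.negUtility (fun s => c s.1) a z t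
      ≤ ∫⁻ ω, (M.marg (c (M.statePath (fun s => c s.1) a z ω t).1) + (-M.u 1).toENNReal)
          ∂M.pathLaw := by
        unfold negUtility
        gcongr with ω
        rw [add_comm]
        exact hu.toENNReal_neg_u_le _
    _ = _ := by
        rw [lintegral_add_right _ measurable_const, lintegral_const, measure_univ, mul_one]

lemma tangent_integrated (hu : M.UtilityAssumption) (hc : Measurable c) (hd : Measurable d)
    (a : ℝ≥0) (z : Z) (t : ℕ) :
    M.posUtility d a z t + M.negUtility (fun s => c s.1) a z t
        + M.pricedConsumption c (fun s => c s.1) a z t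
      ≤ M.posUtility (fun s => c s.1) a z t + M.negUtility d a z t
        + M.pricedConsumption c d a z t := by
  have hc' : Measurable fun s : ℝ≥0 × Z => c s.1 := hc.comp measurable_fst
  have h1 := measurable_toENNReal_u hu hd a z t
  have h2 := measurable_toENNReal_u hu hc' a z t
  have h3 := measurable_toENNReal_neg_u hu hd a z t
  have h4 := measurable_toENNReal_neg_u hu hc' a z t
  have h5 : Measurable fun ω => (M.u (d (M.statePath d a z ω t))).toENNReal
      + (-M.u (c (M.statePath (fun s => c s.1) a z ω t).1)).toENNReal := h1.add h4
  have h6 : Measurable fun ω => (M.u (c (M.statePath (fun s => c s.1) a z ω t).1)).toENNReal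
      + (-M.u (d (M.statePath d a z ω t))).toENNReal := h2.add h3
  unfold posUtility negUtility pricedConsumption
  rw [← lintegral_add_left h1, ← lintegral_add_left h2, ← lintegral_add_left h5,
    ← lintegral_add_left h6]
  exact lintegral_mono fun ω => hu.tangent_ennreal _ _

/-- A policy satisfying the Euler equation dominates every feasible policy, strictly so if the
two differ at the initial state. -/
theorem lifetimeValue_le (hu : M.UtilityAssumption) (hmom : M.MomentAssumption)
    (hθ : M.β * M.meanRet < 1) (hY : M.meanInc ≠ ⊤) (hα : 0 < α) (hc : M.EulerPolicy α κ c)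
    (hd : Feasible d) {a : ℝ≥0} (ha : 0 < a) (z : Z) :
    M.lifetimeValue d a z ≤ M.lifetimeValue (fun s => c s.1) a z ∧
      (d (a, z) ≠ c a → M.lifetimeValue d a z < M.lifetimeValue (fun s => c s.1) a z) := by
  have hcp := hc.toWealthPolicy
  have hcm := hcp.continuous.measurable
  have hcf : Feasible fun s : ℝ≥0 × Z => c s.1 :=
    ⟨hcm.comp measurable_fst, fun a _ => hcp.le_self a⟩
  have hPA := tsum_pricedWealth_ne_top hu hmom hθ hY hα hcp hcf.measurable ha z
  have hPX := tsum_pricedWealth_ne_top hu hmom hθ hY hα hcp hd.measurable ha z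
  -- The state at time 0 is deterministic, so strictness there survives integration as a constant
  -- `δ`.
  obtain ⟨δ, hδ, hineq⟩ : ∃ δ : ℝ≥0∞, (d (a, z) ≠ c a → 0 < δ) ∧
      (M.u (d (a, z))).toENNReal + (-M.u (c a)).toENNReal + M.marg (c a) * c a + δ
        ≤ (M.u (c a)).toENNReal + (-M.u (d (a, z))).toENNReal + M.marg (c a) * d (a, z) := by
    by_cases h : d (a, z) = c a
    · exact ⟨0, fun h' => absurd h h', by simpa using hu.tangent_ennreal (c a) (d (a, z))⟩
    · obtain ⟨δ, h1, h2⟩ := hu.tangent_ennreal_strict (hcp.pos hα ha) h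
      exact ⟨δ, fun _ => h1, h2⟩
  have hmul : ∀ (t : ℕ) {x y : ℝ≥0∞}, x ≤ y → (M.β : ℝ≥0∞) ^ t * x ≤ (M.β : ℝ≥0∞) ^ t * y :=
    fun t x y h => by gcongr
  have hmain := tsum_add_le_of_telescope (δ := δ)
    (g := fun t => (M.β : ℝ≥0∞) ^ t * (M.posUtility d a z t + M.negUtility (fun s => c s.1) a z t))
    (k := fun t => (M.β : ℝ≥0∞) ^ t * (M.posUtility (fun s => c s.1) a z t + M.negUtility d a z t))
    (pc := fun t => (M.β : ℝ≥0∞) ^ t * M.pricedConsumption c (fun s => c s.1) a z t)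
    (pd := fun t => (M.β : ℝ≥0∞) ^ t * M.pricedConsumption c d a z t)
    (px := fun t => (M.β : ℝ≥0∞) ^ t * M.pricedWealth c d a z t)
    (pa := fun t => (M.β : ℝ≥0∞) ^ t * M.pricedWealth c (fun s => c s.1) a z t)
    (fun t => by
      rw [← mul_add, ← mul_add]
      exact hmul t (tangent_integrated hu hcm hd.measurable a z t))
    (by simpa [posUtility, negUtility, pricedConsumption, statePath] using hineq)
    (fun t => by
      simp only [pow_succ, mul_assoc]
      rw [← mul_add, ← mul_add, ← mul_add, ← mul_add]
      exact hmul t (priced_step hu hc hd a z t))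
    (fun t => ne_top_of_le_ne_top (ENNReal.ne_top_of_tsum_ne_top hPA t)
      (hmul t (pricedConsumption_le hcf a z t)))
    (fun t => ne_top_of_le_ne_top (ENNReal.ne_top_of_tsum_ne_top hPX t)
      (hmul t (pricedConsumption_le hd a z t)))
    (ENNReal.ne_top_of_tsum_ne_top hPX) (ENNReal.ne_top_of_tsum_ne_top hPA)
    (by simp [pricedWealth, statePath]) (ENNReal.tendsto_atTop_zero_of_tsum_ne_top hPA)
  simp only [mul_add] at hmain
  rw [ENNReal.tsum_add, ENNReal.tsum_add] at hmain
  have hfin := coe_sub_coe_le_of_add_le (tsum_posUtility_ne_top hu hθ hY hd a z)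
    (tsum_posUtility_ne_top hu hθ hY hcf a z) (tsum_negUtility_ne_top hu hmom hα hcp ha z) hmain
  rw [lifetimeValue_eq hu hd.measurable, lifetimeValue_eq hu hcf.measurable]
  exact ⟨hfin.1, fun h => hfin.2 (hδ h)⟩

end Verification

/-! ### Global stability -/

section Stability

variable {M : IncomeFluctuation Z E F} {α κ : ℝ≥0} {c : ℝ≥0 → ℝ≥0}

/-- A concave policy that consumes at least the fraction `α` of wealth has slope at least `α`. -/
lemma WealthPolicy.mul_sub_le (hc : M.WealthPolicy α κ c) (hconc : WealthConcave c)
    {a b : ℝ≥0} (hab : a ≤ b) : (α : ℝ) * (b - a) ≤ c b - c a := by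
  rcases hab.eq_or_lt with rfl | hlt
  · simp
  rcases eq_zero_or_pos a with rfl | ha
  · have h0 : c 0 = 0 := nonpos_iff_eq_zero.1 (hc.le_self 0)
    have := hc.mul_le b
    rw [h0]
    simpa using (show ((α * b : ℝ≥0) : ℝ) ≤ c b from this)
  have hab' : (a : ℝ) < b := hlt
  have ha' : (0 : ℝ) < a := ha
  by_contra! hcon
  -- If the chord over `[a, b]` had slope below `α`, its extension would bound `c` from above beyond
  -- `b`. The second term of the maximum is where this extension meets the line `α x`; past it, `c x
  -- ≥ α x` fails.
  obtain ⟨x, hx⟩ := exists_gt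
    (max (b : ℝ) (b + (c b - α * b) * (b - a) / (α * (b - a) - (c b - c a))))
  have hbx : (b : ℝ) < x := (le_max_left _ _).trans_lt hx
  have hx2 := (le_max_right _ _).trans_lt hx
  have hslope := hconc.slope_anti_adjacent ha' (show (0 : ℝ) < x by linarith) hab' hbx
  have hx0 : 0 ≤ x := by linarith
  have hcx : α * x ≤ (c x.toNNReal : ℝ) := by
    have := NNReal.coe_le_coe.2 (hc.mul_le x.toNNReal)
    rwa [NNReal.coe_mul, Real.coe_toNNReal x hx0] at this
  simp only [Real.toNNReal_coe] at hslope
  rw [div_le_div_iff₀ (by linarith) (by linarith)] at hslope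
  have hpos : 0 < α * (b - a) - (c b - c a : ℝ) := by linarith
  rw [← sub_pos, ← sub_sub, sub_pos, div_lt_iff₀ hpos] at hx2
  nlinarith

/-- The wealth transition for a given shock. -/
def transition (M : IncomeFluctuation Z E F) (c : ℝ≥0 → ℝ≥0) (w : Z × E × F) (x : ℝ≥0) : ℝ≥0 :=
  M.nextWealth (x - c x) w

/-- The increment of savings lies between 0, by the 1-Lipschitz property of `c`, and `1 - α` times
that of wealth, by the slope bound. -/
lemma edist_transition_le (hα₁ : α < 1) (hc : M.WealthPolicy α κ c) (hconc : WealthConcave c)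
    (w : Z × E × F) (x y : ℝ≥0) :
    edist (M.transition c w x) (M.transition c w y)
      ≤ M.ret w * (1 - α : ℝ≥0) * edist x y := by
  wlog h : y ≤ x generalizing x y
  · rw [edist_comm, edist_comm x]
    exact this y x (le_of_not_ge h)
  have h1 := hc.mul_sub_le hconc h
  have h2 : (c x : ℝ) ≤ c y + (x - y) := by
    have := NNReal.coe_le_coe.2 (hc.le_add y x h)
    rwa [NNReal.coe_add, NNReal.coe_sub h] at this
  rw [edist_nndist, edist_nndist]
  norm_cast
  rw [← NNReal.coe_le_coe]
  push_cast [NNReal.coe_sub hα₁.le]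
  rw [NNReal.dist_eq, NNReal.dist_eq, abs_of_nonneg (sub_nonneg.2 (NNReal.coe_le_coe.2 h))]
  simp only [transition, nextWealth]
  push_cast [NNReal.coe_sub (hc.le_self x), NNReal.coe_sub (hc.le_self y)]
  have e : (M.ret w : ℝ) * (x - c x) + M.inc w - (M.ret w * (y - c y) + M.inc w)
      = M.ret w * ((x - y) - (c x - c y)) := by ring
  rw [e, abs_of_nonneg (mul_nonneg (NNReal.coe_nonneg _) (by linarith)), mul_assoc]
  gcongr
  linarith

lemma measurable_transition (hc : Measurable c) :
    Measurable fun p : ℝ≥0 × (Z × E × F) => M.transition c p.2 p.1 :=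
  measurable_nextWealth.comp
    ((measurable_fst.sub (hc.comp measurable_fst)).prodMk measurable_snd)

/-- Backward iterates of the wealth transitions. -/
def backward (M : IncomeFluctuation Z E F) (c : ℝ≥0 → ℝ≥0) (ω : ℕ → Z × E × F) :
    ℕ → ℝ≥0 → ℝ≥0
  | 0, x => x
  | t + 1, x => backward M c ω t (M.transition c (ω t) x)

lemma measurable_backward (hc : Measurable c) (t : ℕ) :
    Measurable fun p : (ℕ → Z × E × F) × ℝ≥0 => M.backward c p.1 t p.2 := by
  induction t with
  | zero => exact measurable_snd
  | succ t ih =>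
    exact ih.comp (measurable_fst.prodMk ((measurable_transition hc).comp
      (measurable_snd.prodMk ((measurable_pi_apply t).comp measurable_fst))))

lemma backward_congr (c : ℝ≥0 → ℝ≥0) {ω ω' : ℕ → Z × E × F} (t : ℕ)
    (h : ∀ i < t, ω i = ω' i) (x : ℝ≥0) : M.backward c ω t x = M.backward c ω' t x := by
  induction t generalizing x with
  | zero => rfl
  | succ t ih =>
    rw [backward, backward, h t (Nat.lt_succ_self t), ih fun i hi => h i (hi.trans t.lt_succ_self)]

/-- The product of the contraction factors of the first `t` transitions. -/
def contraction (M : IncomeFluctuation Z E F) (α : ℝ≥0) (t : ℕ) (ω : ℕ → Z × E × F) : ℝ≥0∞ :=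
  ∏ i ∈ Finset.range t, ((M.ret (ω i) : ℝ≥0∞) * (1 - α : ℝ≥0))

lemma measurable_contraction (α : ℝ≥0) (t : ℕ) : Measurable (M.contraction α t) :=
  Finset.measurable_prod _ fun i _ =>
    (M.measurable_ret.comp (measurable_pi_apply i)).coe_nnreal_ennreal.mul_const _

lemma lintegral_contraction (α : ℝ≥0) (t : ℕ) :
    ∫⁻ ω, M.contraction α t ω ∂M.pathLaw = ((1 - α : ℝ≥0) * M.meanRet) ^ t := by
  unfold contraction
  simp only [Finset.prod_mul_distrib, Finset.prod_const, Finset.card_range]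
  rw [lintegral_mul_const' _ _ (ENNReal.pow_ne_top ENNReal.coe_ne_top), ← expProdRet,
    expProdRet_eq, mul_pow, mul_comm]

/-- The newest shock acts innermost, so a further step only perturbs the argument of a map that is
already strongly contracting on average. -/
lemma edist_backward_le (hα₁ : α < 1) (hc : M.WealthPolicy α κ c) (hconc : WealthConcave c)
    (ω : ℕ → Z × E × F) (t : ℕ) (x y : ℝ≥0) :
    edist (M.backward c ω t x) (M.backward c ω t y) ≤ M.contraction α t ω * edist x y := by
  induction t generalizing x y with
  | zero => simp [backward, contraction]
  | succ t ih =>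
    refine (ih _ _).trans ?_
    have e : M.contraction α (t + 1) ω
        = M.contraction α t ω * ((M.ret (ω t) : ℝ≥0∞) * (1 - α : ℝ≥0)) :=
      Finset.prod_range_succ _ _
    rw [e, mul_assoc]
    gcongr
    exact edist_transition_le hα₁ hc hconc _ _ _

lemma transition_zero (c : ℝ≥0 → ℝ≥0) (w : Z × E × F) :
    M.transition c w 0 = M.inc w := by
  simp [transition, nextWealth]

/-- The backward iterates converge almost surely, to a limit that does not depend on the starting
point. -/
lemma exists_backward_limit (hα₁ : α < 1) (hL : (1 - α : ℝ≥0) * M.meanRet < 1)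
    (hY : M.meanInc ≠ ⊤) (hc : M.WealthPolicy α κ c) (hconc : WealthConcave c) :
    ∃ X : (ℕ → Z × E × F) → ℝ≥0, Measurable X ∧
      ∀ᵐ ω ∂M.pathLaw, ∀ x, Tendsto (fun t => M.backward c ω t x) atTop (𝓝 (X ω)) := by
  have hcm := hc.continuous.measurable
  have hinc : ∀ t, Measurable fun ω : ℕ → Z × E × F => (M.inc (ω t) : ℝ≥0∞) := fun t =>
    (M.measurable_inc.comp (measurable_pi_apply t)).coe_nnreal_ennreal
  have hmeas : ∀ t, Measurable fun ω => M.contraction α t ω * (1 + M.inc (ω t)) := fun t =>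
    (measurable_contraction α t).mul (measurable_const.add (hinc t))
  -- The income term bounds consecutive differences of the iterates from 0, since one step from 0
  -- lands at `Y`. The added 1 makes the contraction factors themselves summable, hence null, which
  -- removes the starting point.
  have hintegral : ∀ t, ∫⁻ ω, M.contraction α t ω * (1 + M.inc (ω t)) ∂M.pathLaw
      = ((1 - α : ℝ≥0) * M.meanRet) ^ t * (1 + M.meanInc) := by
    intro t
    rw [M.lintegral_pathLaw_eq (t := t) (measurable_contraction α t)
      (fun ω ω' h => Finset.prod_congr rfl fun i hi => by rw [h i (Finset.mem_range.1 hi)])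
      (G := fun p w => p * (1 + (M.inc w : ℝ≥0∞)))
      (measurable_fst.mul (measurable_const.add
        (M.measurable_inc.comp measurable_snd).coe_nnreal_ennreal)),
      ← lintegral_contraction, ← lintegral_mul_const _ (measurable_contraction α t)]
    refine lintegral_congr fun ω => ?_
    have hm : Measurable fun w => 1 + (M.inc w : ℝ≥0∞) :=
      measurable_const.add M.measurable_inc.coe_nnreal_ennreal
    rw [lintegral_const_mul _ hm, lintegral_add_left measurable_const, lintegral_const,
      measure_univ, mul_one, meanInc]
  have hsum : ∀ᵐ ω ∂M.pathLaw, ∑' t, M.contraction α t ω * (1 + M.inc (ω t)) < ⊤ := by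
    refine ae_lt_top (Measurable.tsum hmeas) ?_
    rw [lintegral_tsum fun t => (hmeas t).aemeasurable]
    simp only [hintegral]
    rw [ENNReal.tsum_mul_right, ENNReal.tsum_geometric]
    exact ENNReal.mul_ne_top (ENNReal.inv_ne_top.2 (tsub_pos_of_lt hL).ne')
      (ENNReal.add_ne_top.2 ⟨ENNReal.one_ne_top, hY⟩)
  have hconv : ∀ᵐ ω ∂M.pathLaw, ∃ l, Tendsto (fun t => M.backward c ω t 0) atTop (𝓝 l) := by
    filter_upwards [hsum] with ω hω
    refine cauchySeq_tendsto_of_complete (cauchySeq_of_edist_le_of_tsum_ne_top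
      (fun t => M.contraction α t ω * (1 + M.inc (ω t))) (fun t => ?_) hω.ne)
    refine (edist_backward_le hα₁ hc hconc ω t _ _).trans ?_
    gcongr
    rw [transition_zero c, edist_comm, edist_nndist, NNReal.nndist_zero_eq_val']
    exact le_add_self
  obtain ⟨X, hX, hlim⟩ := measurable_limit_of_tendsto_metrizable_ae
    (f := fun t ω => M.backward c ω t 0) (fun t => ((measurable_backward (M := M) hcm t).comp
      (measurable_id.prodMk measurable_const)).aemeasurable) hconv
  refine ⟨X, hX, ?_⟩
  filter_upwards [hsum, hlim] with ω hω hω' x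
  have h0 : Tendsto (fun t => M.contraction α t ω) atTop (𝓝 0) :=
    tendsto_of_tendsto_of_tendsto_of_le_of_le tendsto_const_nhds
      (ENNReal.tendsto_atTop_zero_of_tsum_ne_top hω.ne) (fun _ => zero_le)
      (fun t => le_mul_of_one_le_right zero_le le_self_add)
  have h1 : Tendsto (fun t => M.contraction α t ω * edist x 0) atTop (𝓝 (0 * edist x 0)) :=
    ENNReal.Tendsto.mul_const h0 (Or.inr (edist_ne_top _ _))
  rw [zero_mul] at h1
  rw [tendsto_iff_edist_tendsto_0] at hω' ⊢
  have h2 := h1.add hω'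
  rw [add_zero] at h2
  refine tendsto_of_tendsto_of_tendsto_of_le_of_le tendsto_const_nhds h2 (fun _ => zero_le)
    (fun t => (edist_triangle _ (M.backward c ω t 0) _).trans ?_)
  gcongr
  exact edist_backward_le hα₁ hc hconc ω t x 0

/-! ### Laws of wealth and weak convergence -/

lemma wealthKernel_apply (hc : Measurable c) (x : ℝ≥0) :
    M.wealthKernel c x = M.shock.map fun w => M.transition c w x := by
  have hm := measurable_transition (M := M) hc
  rw [wealthKernel, Kernel.map_apply _ (show Measurable fun p : ℝ≥0 × (Z × E × F) =>
      M.nextWealth (p.1 - c p.1) p.2 from hm), Kernel.prod_apply, Kernel.id_apply,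
    Kernel.const_apply, Measure.dirac_prod, Measure.map_map (show Measurable
      fun p : ℝ≥0 × (Z × E × F) => M.nextWealth (p.1 - c p.1) p.2 from hm) (by fun_prop)]
  rfl

/-- The `t`-step transition probabilities are the laws of the backward iterates. -/
lemma wealthKernel_pow_apply (hc : Measurable c) (t : ℕ) (x : ℝ≥0) :
    (M.wealthKernel c ^ t : Kernel ℝ≥0 ℝ≥0) x = M.pathLaw.map fun ω => M.backward c ω t x := by
  have hB : ∀ t x, Measurable fun ω => M.backward c ω t x := fun t x =>
    (measurable_backward (M := M) hc t).comp (measurable_id.prodMk measurable_const)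
  have hF : ∀ x, Measurable fun w => M.transition c w x := fun x =>
    (measurable_transition (M := M) hc).comp (measurable_const.prodMk measurable_id)
  induction t generalizing x with
  | zero =>
    have : (M.wealthKernel c ^ 0 : Kernel ℝ≥0 ℝ≥0) x = Measure.dirac x := by
      rw [pow_zero]; exact Kernel.id_apply x
    rw [this]
    simp [backward]
  | succ t ih =>
    refine Measure.ext_of_lintegral _ fun h hh => ?_
    have e : (M.wealthKernel c ^ (t + 1) : Kernel ℝ≥0 ℝ≥0)
        = (M.wealthKernel c ^ t : Kernel ℝ≥0 ℝ≥0) ∘ₖ M.wealthKernel c := pow_succ _ _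
    have hmeas : Measurable fun y => ∫⁻ b, h b ∂(M.wealthKernel c ^ t : Kernel ℝ≥0 ℝ≥0) y :=
      hh.lintegral_kernel
    rw [e, Kernel.lintegral_comp _ _ _ hh, wealthKernel_apply hc, lintegral_map hmeas (hF x),
      lintegral_map hh (hB _ _)]
    simp only [ih, backward]
    have hG : Measurable fun p : (ℕ → Z × E × F) × (Z × E × F) =>
        h (M.backward c p.1 t (M.transition c p.2 x)) :=
      hh.comp ((measurable_backward hc t).comp
        (measurable_fst.prodMk ((hF x).comp measurable_snd)))
    -- Conditioning on the newest shock in the backward iterate matches the first step of the chain;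
    -- this is where the iid assumption equates the two laws.
    rw [M.lintegral_pathLaw_swap t hG fun ω ω' w h' => by
      simp only [backward_congr c t h']]
    exact lintegral_congr fun w => lintegral_map hh (hB _ _)

lemma bind_wealthKernel_pow (hc : Measurable c) (ψ₀ : Measure ℝ≥0) [SFinite ψ₀] (t : ℕ) :
    ψ₀.bind (M.wealthKernel c ^ t : Kernel ℝ≥0 ℝ≥0)
      = (ψ₀.prod M.pathLaw).map fun p => M.backward c p.2 t p.1 := by
  have hm : Measurable fun p : ℝ≥0 × (ℕ → Z × E × F) => M.backward c p.2 t p.1 :=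
    (measurable_backward hc t).comp measurable_swap
  refine Measure.ext_of_lintegral _ fun h hh => ?_
  have hhm := hh.comp hm
  simp only [Function.comp_def] at hhm
  rw [Measure.lintegral_bind (Kernel.aemeasurable _) hh.aemeasurable, lintegral_map hh hm,
    lintegral_prod _ hhm.aemeasurable]
  refine lintegral_congr fun x => ?_
  rw [wealthKernel_pow_apply hc]
  exact lintegral_map hh (hm.comp (measurable_const.prodMk measurable_id))

lemma bind_wealthKernel (hc : Measurable c) (ψ₀ : Measure ℝ≥0) [SFinite ψ₀] :
    ψ₀.bind (M.wealthKernel c)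
      = (ψ₀.prod M.shock).map fun p => M.transition c p.2 p.1 := by
  have hm := measurable_transition (M := M) hc
  refine Measure.ext_of_lintegral _ fun h hh => ?_
  have hhm := hh.comp hm
  simp only [Function.comp_def] at hhm
  rw [Measure.lintegral_bind (Kernel.aemeasurable _) hh.aemeasurable, lintegral_map hh hm,
    lintegral_prod _ hhm.aemeasurable]
  refine lintegral_congr fun x => ?_
  rw [wealthKernel_apply hc]
  exact lintegral_map hh (hm.comp (measurable_const.prodMk measurable_id))

/-- Draw the starting point independently of the shocks: the backward iterates still converge almost
surely, and bounded convergence applies. -/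
lemma tendsto_integral_bind_pow (hc : Measurable c) {X : (ℕ → Z × E × F) → ℝ≥0}
    (hX : Measurable X)
    (hlim : ∀ᵐ ω ∂M.pathLaw, ∀ x, Tendsto (fun t => M.backward c ω t x) atTop (𝓝 (X ω)))
    (ψ₀ : Measure ℝ≥0) [IsProbabilityMeasure ψ₀] (h : ℝ≥0 →ᵇ ℝ) :
    Tendsto (fun t : ℕ => ∫ x, h x ∂(ψ₀.bind (M.wealthKernel c ^ t : Kernel ℝ≥0 ℝ≥0))) atTop
      (𝓝 (∫ x, h x ∂(M.pathLaw.map X))) := by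
  have hm : ∀ t, Measurable fun p : ℝ≥0 × (ℕ → Z × E × F) => M.backward c p.2 t p.1 := fun t =>
    (measurable_backward hc t).comp measurable_swap
  have hh := h.continuous.measurable
  have e : ∫ x, h x ∂(M.pathLaw.map X) = ∫ p, h (X p.2) ∂(ψ₀.prod M.pathLaw) := by
    have hs : (ψ₀.prod M.pathLaw).map Prod.snd = M.pathLaw := by simp
    rw [← hs, Measure.map_map hX measurable_snd,
      integral_map (hX.comp measurable_snd).aemeasurable hh.aestronglyMeasurable]
    simp
  rw [e]
  simp only [bind_wealthKernel_pow hc]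
  simp only [fun t => integral_map (hm t).aemeasurable
    (μ := ψ₀.prod M.pathLaw) (f := h) hh.aestronglyMeasurable]
  refine tendsto_integral_of_dominated_convergence (fun _ => ‖h‖)
    (fun t => (hh.comp (hm t)).aestronglyMeasurable) (integrable_const _)
    (fun t => ae_of_all _ fun p => h.norm_coe_le_norm _) ?_
  filter_upwards [Measure.quasiMeasurePreserving_snd.ae hlim] with p hp
  exact (h.continuous.tendsto _).comp (hp p.1)

/-- The wealth kernel maps bounded continuous functions to bounded continuous functions. -/
lemma exists_boundedContinuous_integral (hc : Continuous c) (h : ℝ≥0 →ᵇ ℝ) :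
    ∃ k : ℝ≥0 →ᵇ ℝ, ∀ μ : Measure ℝ≥0, IsProbabilityMeasure μ →
      ∫ x, h x ∂(μ.bind (M.wealthKernel c)) = ∫ x, k x ∂μ := by
  have hh := h.continuous.measurable
  have hm := measurable_transition (M := M) hc.measurable
  have hF : ∀ x, Measurable fun w => M.transition c w x := fun x =>
    hm.comp (measurable_const.prodMk measurable_id)
  have hcont : Continuous fun x => ∫ w, h (M.transition c w x) ∂M.shock := by
    refine continuous_of_dominated (bound := fun _ => ‖h‖)
      (fun x => (hh.comp (hF x)).aestronglyMeasurable)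
      (fun x => ae_of_all _ fun w => h.norm_coe_le_norm _) (integrable_const _)
      (ae_of_all _ fun w => h.continuous.comp ?_)
    unfold transition nextWealth
    fun_prop
  refine ⟨BoundedContinuousFunction.ofNormedAddCommGroup _ hcont ‖h‖ fun x => ?_, fun μ hμ => ?_⟩
  · refine (norm_integral_le_of_norm_le_const (ae_of_all _ fun w => h.norm_coe_le_norm _)).trans ?_
    simp
  · rw [bind_wealthKernel hc.measurable, integral_map hm.aemeasurable hh.aestronglyMeasurable,
      integral_prod (fun p => h (M.transition c p.2 p.1))
        (Integrable.of_bound (hh.comp hm).aestronglyMeasurable ‖h‖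
        (ae_of_all _ fun p => h.norm_coe_le_norm _))]
    rfl

/-- Stationarity comes from the Feller property, as `δ_0 Q^t` and `δ_0 Q^(t+1)` have the same limit.
A stationary law is constant along the iteration and so equals that limit. -/
theorem globallyStable_wealthKernel (hα₁ : α < 1) (hL : (1 - α : ℝ≥0) * M.meanRet < 1)
    (hY : M.meanInc ≠ ⊤) (hc : M.WealthPolicy α κ c) (hconc : WealthConcave c) :
    GloballyStable (M.wealthKernel c) := by
  have hcm := hc.continuous.measurable
  obtain ⟨X, hX, hlim⟩ := exists_backward_limit hα₁ hL hY hc hconc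
  have hψ : IsProbabilityMeasure (M.pathLaw.map X) :=
    Measure.isProbabilityMeasure_map hX.aemeasurable
  have hbindprob : ∀ μ : Measure ℝ≥0, IsProbabilityMeasure μ →
      IsProbabilityMeasure (μ.bind (M.wealthKernel c)) := fun μ _ => by
    rw [bind_wealthKernel hcm]
    exact Measure.isProbabilityMeasure_map (measurable_transition hcm).aemeasurable
  refine ⟨M.pathLaw.map X, hψ, ?_, fun φ hφ hstat => ?_,
    fun ψ₀ _ h => tendsto_integral_bind_pow hcm hX hlim ψ₀ h⟩
  · have := hbindprob _ hψ
    refine ext_of_forall_integral_eq_of_IsFiniteMeasure fun h => ?_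
    obtain ⟨k, hk⟩ := exists_boundedContinuous_integral (M := M) hc.continuous h
    have hprob : ∀ t, IsProbabilityMeasure
        ((Measure.dirac 0).bind (M.wealthKernel c ^ t : Kernel ℝ≥0 ℝ≥0)) := fun t => by
      rw [bind_wealthKernel_pow hcm]
      exact Measure.isProbabilityMeasure_map
        ((measurable_backward hcm t).comp measurable_swap).aemeasurable
    have h1 := tendsto_integral_bind_pow hcm hX hlim (Measure.dirac 0) k
    have h2 := (tendsto_integral_bind_pow hcm hX hlim (Measure.dirac 0) h).comp
      (tendsto_add_atTop_nat 1)
    rw [hk _ hψ]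
    refine tendsto_nhds_unique h1 (h2.congr fun t => ?_)
    rw [← hk _ (hprob t), Function.comp_apply, pow_succ',
      Measure.bind_bind (Kernel.aemeasurable _) (Kernel.aemeasurable _)]
    rfl
  · have hpow : ∀ t : ℕ, φ.bind (M.wealthKernel c ^ t : Kernel ℝ≥0 ℝ≥0) = φ := by
      intro t
      induction t with
      | zero => rw [bind_wealthKernel_pow hcm]; simp [backward]
      | succ t ih =>
        nth_rewrite 2 [← hstat]
        nth_rewrite 2 [← ih]
        rw [pow_succ', Measure.bind_bind (Kernel.aemeasurable _) (Kernel.aemeasurable _)]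
        rfl
    refine ext_of_forall_integral_eq_of_IsFiniteMeasure fun h => ?_
    have := tendsto_integral_bind_pow hcm hX hlim φ h
    simp only [hpow] at this
    exact tendsto_nhds_unique tendsto_const_nhds this

end Stability

end

end IncomeFluctuation

/-! ### The main theorem -/

theorem theoremt {m : ℕ} (Z : Set (EuclideanSpace ℝ (Fin m))) (hZ : MeasurableSet Z)
    {E F : Type*} [MeasurableSpace E] [MeasurableSpace F] (M : IncomeFluctuation Z E F)
    (hu : M.UtilityAssumption)
    (hcontr : M.ContractionAssumption)
    (hYsum : M.IncomeSumAssumption)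
    (hmom : M.MomentAssumption)
    (hcont : M.ContinuityAssumption)
    (hsav : M.SavingAssumption)
    (hYbd : M.IncomeBoundAssumption)
    (hconc : M.ConcavityAssumption) :
    ∃ c : ℝ≥0 → ℝ≥0,
      -- the policy `(a, z) ↦ c a` is the unique optimal policy, and a candidate policy
      M.Optimal (fun s => c s.1) ∧
      (∀ d : ℝ≥0 × Z → ℝ≥0, M.Optimal d → d = fun s => c s.1) ∧
      M.Candidate (fun s => c s.1) ∧
      -- the wealth process under it is globally stable
      GloballyStable (M.wealthKernel c) := by
  obtain ⟨α, hα, hα₁, hsav, hn⟩ := hsav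
  have hθ := IncomeFluctuation.mul_meanRet_lt_one_of_pow hcontr
  have hL := IncomeFluctuation.mul_meanRet_lt_one_of_pow hn
  have hY := hYbd.meanInc_ne_top
  obtain ⟨κ, c, hc, hcc⟩ := IncomeFluctuation.exists_eulerPolicy hu hmom hconc hθ hα hα₁ hsav
  have hcp := hc.toWealthPolicy
  have hfeas : IncomeFluctuation.Feasible fun s : ℝ≥0 × Z => c s.1 :=
    ⟨hcp.continuous.measurable.comp measurable_fst, fun a _ => hcp.le_self a⟩
  refine ⟨c, ⟨hfeas, fun d hd a z ha => ?_⟩, fun d hd => ?_, hcp.candidate hu hα,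
    IncomeFluctuation.globallyStable_wealthKernel hα₁ hL hY hcp hcc⟩
  · exact (IncomeFluctuation.lifetimeValue_le hu hmom hθ hY hα hc hd ha z).1
  · funext ⟨a, z⟩
    -- Optimality says nothing at zero wealth, but feasibility forces zero consumption there. At
    -- positive wealth, a difference at one state already costs value at that state.
    rcases eq_zero_or_pos a with rfl | ha
    · exact (nonpos_iff_eq_zero.1 (hd.1.le 0 z)).trans (nonpos_iff_eq_zero.1 (hcp.le_self 0)).symm
    · by_contra h
      exact ((IncomeFluctuation.lifetimeValue_le hu hmom hθ hY hα hc hd.1 ha z).2 h).not_ge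
        (hd.2 _ hfeas a z ha)
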